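/- Let $h>0$ and let $\mathbb D_h$ be the space of càdlàg paths $\omega:[0,\infty)\to h\mathbb Z$, with coordinate process $X=(X_t)_{t\ge 0}$, $X_t(\omega)=\omega(t)$, the $\sigma$-algebra $\mathcal F=\sigma(X_s:s\ge 0)$ and the filtration $\mathcal F_t=\sigma(X_s:s\le t)$, $t\ge 0$. Let $\mathsf P$ be a probability measure on $\mathcal F$ under which $X$ is an upwards skip-free Lévy chain, i.e. a compound Poisson process, started at $0$, whose (finite, nonzero) Lévy measure $\lambda$, with $\lambda(\{0\})=0$, satisfies $\mathrm{supp}(\lambda)\subset h\mathbb Z$ and $\mathrm{supp}(\lambda|_{(0,\infty)})=\{h\}$. Let $\psi(\beta)=\int_{\mathbb R}(e^{\beta x}-1)\,\lambda(dx)$, $\beta\ge 0$, be its Laplace exponent, let $\Phi(0)$ be the largest zero of $\psi$ on $[0,\infty)$, and assume $\Phi(0)>0$. Put $T_x=\inf\{t\ge 0: X_t\ge x\}$ and $\overline X_\infty=\sup_{s\ge 0}X_s$. Then there is a unique measure $\mathsf P^\natural=\mathsf P_{\Phi(0)}$ on $\mathcal F$ such that $$\mathsf P^\natural(\Lambda)=\mathsf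 E\left[\exp\{\Phi(0)X_t-\psi(\Phi(0))t\}\mathbf 1_\Lambda\right]\qquad(\Lambda\in\mathcal F_t,\ t\ge 0),$$ and the following hold. (1) For every $\Lambda\in\bigcup_{t\ge 0}\mathcal F_t$, $\lim_{n\to\infty}\mathsf P(\Lambda\mid\overline X_\infty\ge nh)=\mathsf P^\natural(\Lambda)$. (2) For every $x\ge 0$, the stopped process $X^{T_x}=(X_{t\wedge T_x})_{t\ge 0}$, as a random element of $\mathbb D_h$, has the same law under $\mathsf P^\natural$ as under $\mathsf P(\,\cdot\mid T_x<\infty)$. -/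

import Mathlib

open MeasureTheory ProbabilityTheory Filter Topology
open scoped NNReal ENNReal

namespace SkipFree

noncomputable section

/-- A function of time `t ∈ [0, ∞)` is càdlàg: right-continuous with left limits
(there is nothing to require of the left limit at time `0`). -/
structure IsCadlag (f : ℝ≥0 → ℝ) : Prop where
  right_continuous : ∀ t, ContinuousWithinAt f (Set.Ici t) t
  left_limits : ∀ t, ∃ l, Tendsto f (𝓝[<] t) (𝓝 l)

/-- A Lévy process `X` relative to a filtration `𝓕`, with every sample path càdlàg. -/
structure IsLevyProcess {Ω : Type*} {m : MeasurableSpace Ω} (𝓕 : Filtration ℝ≥0 m)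
    (X : ℝ≥0 → Ω → ℝ) (P : Measure Ω) : Prop where
  isProbabilityMeasure : IsProbabilityMeasure P
  adapted : ∀ t, Measurable[𝓕 t] (X t)
  cadlag : ∀ ω, IsCadlag (fun t => X t ω)
  zero : ∀ᵐ ω ∂P, X 0 ω = 0
  independent_increments : ∀ s t,
    Indep (MeasurableSpace.comap (fun ω => X (s + t) ω - X s ω) inferInstance) (𝓕 s) P
  stationary_increments : ∀ s t, P.map (fun ω => X (s + t) ω - X s ω) = P.map (X t)

/-- `X` is a compound Poisson process with Lévy measure `ν`: a Lévy process such that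
`E[exp(ipX_t)] = exp(t ∫ (exp(ipx) - 1) ν(dx))`, where `ν` is finite, nonzero and does not
charge `{0}`. -/
structure IsCompoundPoissonProcess {Ω : Type*} {m : MeasurableSpace Ω} (𝓕 : Filtration ℝ≥0 m)
    (X : ℝ≥0 → Ω → ℝ) (P : Measure Ω) (ν : Measure ℝ) : Prop where
  isLevyProcess : IsLevyProcess 𝓕 X P
  isFiniteMeasure : IsFiniteMeasure ν
  ne_zero : ν ≠ 0
  singleton_zero : ν {0} = 0
  charFun_eq : ∀ (t : ℝ≥0) (p : ℝ), charFun (P.map (X t)) p =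
    Complex.exp ((t : ℂ) * ∫ x, (Complex.exp (Complex.I * p * x) - 1) ∂ν)

/-- `X` is an upwards skip-free Lévy chain on the lattice `hℤ`, with Lévy measure `ν`:
`supp ν ⊆ hℤ` and the support of the restriction of `ν` to `(0, ∞)` is `{h}`. -/
structure IsUpwardsSkipFreeLevyChain {Ω : Type*} {m : MeasurableSpace Ω} (𝓕 : Filtration ℝ≥0 m)
    (X : ℝ≥0 → Ω → ℝ) (P : Measure Ω) (h : ℝ) (ν : Measure ℝ) : Prop where
  isCompoundPoissonProcess : IsCompoundPoissonProcess 𝓕 X P ν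
  pos : 0 < h
  support_subset : ν.support ⊆ (AddSubgroup.zmultiples h : Set ℝ)
  support_restrict_eq : (ν.restrict (Set.Ioi 0)).support = {h}

/-- The Laplace exponent `ψ(β) = ∫ (exp(βx) - 1) ν(dx)`, for real `β ≥ 0`. -/
def laplaceExponent (ν : Measure ℝ) (β : ℝ) : ℝ := ∫ x, (Real.exp (β * x) - 1) ∂ν

/-- `Φ(0)`: the largest zero of the Laplace exponent on `[0, ∞)`. -/
def largestZero (ν : Measure ℝ) : ℝ := sSup {β : ℝ | 0 ≤ β ∧ laplaceExponent ν β = 0}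

/-- The canonical space of càdlàg paths `[0, ∞) → hℤ`. Its σ-algebra (that of a subtype of a
product space) is the one generated by the evaluation maps. -/
abbrev PathSpace (h : ℝ) : Type :=
  {ω : ℝ≥0 → ℝ // IsCadlag ω ∧ ∀ t, ω t ∈ AddSubgroup.zmultiples h}

/-- The coordinate process. -/
def coord (h : ℝ) (t : ℝ≥0) (ω : PathSpace h) : ℝ := ω.1 t

theorem measurable_coord (h : ℝ) (t : ℝ≥0) : Measurable (coord h t) :=
  (measurable_pi_apply t).comp measurable_subtype_coe

/-- The natural filtration of the coordinate process: `𝓕_t` is generated by the evaluations at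
the times `s ≤ t`. -/
def canonicalFiltration (h : ℝ) :
    Filtration ℝ≥0 (inferInstance : MeasurableSpace (PathSpace h)) :=
  Filtration.natural (coord h) fun t => (measurable_coord h t).stronglyMeasurable

/-- `Q` is the exponential change of measure `P_c` of `P`:
`Q(Λ) = E[exp(c X_t - ψ(c) t) 1_Λ]` for all `t ≥ 0` and `Λ ∈ 𝓕_t`. -/
def IsExponentialChange {h : ℝ} (P : Measure (PathSpace h)) (ν : Measure ℝ) (c : ℝ)
    (Q : Measure (PathSpace h)) : Prop :=
  ∀ (t : ℝ≥0) (Λ : Set (PathSpace h)), MeasurableSet[canonicalFiltration h t] Λ →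
    Q Λ = ∫⁻ ω in Λ, ENNReal.ofReal (Real.exp (c * coord h t ω - laplaceExponent ν c * t)) ∂P

/-- The overall supremum of a path, with values in `[-∞, ∞]`. -/
def overallSup {h : ℝ} (ω : PathSpace h) : EReal := ⨆ t : ℝ≥0, (coord h t ω : EReal)

/-- The first entrance time `T_x` of the coordinate process into `[x, ∞)`, equal to `⊤` if the
path never enters. -/
def entranceTime (h x : ℝ) : PathSpace h → WithTop ℝ≥0 :=
  hittingAfter (coord h) (Set.Ici x) 0

theorem IsCadlag.stopped {f : ℝ≥0 → ℝ} (hf : IsCadlag f) (τ : WithTop ℝ≥0) :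
    IsCadlag (fun t : ℝ≥0 => f (min (t : WithTop ℝ≥0) τ).untopA) := by
  induction τ using WithTop.recTopCoe with
  | top =>
    have key : (fun t : ℝ≥0 => f (min (t : WithTop ℝ≥0) (⊤ : WithTop ℝ≥0)).untopA) = f := by
      funext t
      rw [min_top_right]
      rfl
    rw [key]
    exact hf
  | coe τ =>
    have key : (fun t : ℝ≥0 => f (min (t : WithTop ℝ≥0) (τ : WithTop ℝ≥0)).untopA) =
        fun t => f (min t τ) := by
      funext t
      rw [← WithTop.coe_min]
      rfl
    rw [key]
    refine ⟨fun t => ?_, fun t => ?_⟩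
    · refine (hf.right_continuous (min t τ)).comp
        (t := Set.Ici (min t τ)) (f := fun t => min t τ) ?_ ?_
      · exact (continuous_id.min continuous_const).continuousWithinAt
      · intro s hs
        exact min_le_min_right τ hs
    · rcases le_or_gt t τ with h | h
      · obtain ⟨l, hl⟩ := hf.left_limits t
        refine ⟨l, hl.congr' ?_⟩
        filter_upwards [self_mem_nhdsWithin] with s hs
        rw [min_eq_left ((le_of_lt hs).trans h)]
      · refine ⟨f τ, tendsto_const_nhds.congr' ?_⟩
        filter_upwards [mem_nhdsWithin_of_mem_nhds (lt_mem_nhds h)] with s hs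
        rw [min_eq_right (le_of_lt hs)]

/-- The process `(X_{t ∧ T_x})_{t ≥ 0}` stopped at `T_x`, as a map of the canonical space into
itself. -/
def stoppedPath (h x : ℝ) (ω : PathSpace h) : PathSpace h :=
  ⟨fun t => stoppedProcess (coord h) (entranceTime h x) t ω,
    ω.2.1.stopped (entranceTime h x ω), fun _ => ω.2.2 _⟩

end

end SkipFree

namespace SkipFree

noncomputable section

/-- The `n`-fold convolution power of a measure on the line. -/
def convPow (ν : Measure ℝ) : ℕ → Measure ℝ
  | 0 => Measure.dirac 0
  | n + 1 => ν ∗ convPow ν n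

instance isFiniteMeasure_convPow (ν : Measure ℝ) [IsFiniteMeasure ν] (n : ℕ) :
    IsFiniteMeasure (convPow ν n) := by
  induction n with
  | zero => unfold convPow; infer_instance
  | succ n ih => unfold convPow; infer_instance

theorem charFun_convPow (ν : Measure ℝ) [IsFiniteMeasure ν] (n : ℕ) (p : ℝ) :
    charFun (convPow ν n) p = charFun ν p ^ n := by
  induction n with
  | zero => simp [convPow]
  | succ n ih => rw [convPow, charFun_conv, ih, pow_succ']

theorem lintegral_exp_convPow (ν : Measure ℝ) [IsFiniteMeasure ν] (β : ℝ) (n : ℕ) :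
    ∫⁻ x, ENNReal.ofReal (Real.exp (β * x)) ∂convPow ν n =
      (∫⁻ x, ENNReal.ofReal (Real.exp (β * x)) ∂ν) ^ n := by
  have hm : Measurable fun x : ℝ => ENNReal.ofReal (Real.exp (β * x)) := by fun_prop
  induction n with
  | zero => simp [convPow]
  | succ n ih =>
    rw [convPow, Measure.lintegral_conv hm, pow_succ', ← ih]
    simp_rw [mul_add, Real.exp_add, ENNReal.ofReal_mul (Real.exp_pos _).le]
    simp_rw [lintegral_const_mul _ hm]
    rw [lintegral_mul_const _ hm]

/-- The compound Poisson law `exp(-t λ) ∑ tⁿ / n! νⁿ`, with `λ` the total mass of `ν`. -/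
def compoundPoisson (ν : Measure ℝ) (t : ℝ) : Measure ℝ :=
  Measure.sum fun n : ℕ =>
    ENNReal.ofReal (Real.exp (-(t * ν.real Set.univ)) * (t ^ n / n.factorial)) • convPow ν n

theorem integral_exp_eq (ν : Measure ℝ) [IsFiniteMeasure ν] {β : ℝ}
    (hβ : Integrable (fun x => Real.exp (β * x)) ν) :
    ∫ x, Real.exp (β * x) ∂ν = laplaceExponent ν β + ν.real Set.univ := by
  rw [laplaceExponent, integral_sub hβ (integrable_const _)]
  simp

theorem lintegral_exp_compoundPoisson (ν : Measure ℝ) [IsFiniteMeasure ν] {t : ℝ} (ht : 0 ≤ t)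
    {β : ℝ} (hβ : Integrable (fun x => Real.exp (β * x)) ν) :
    ∫⁻ x, ENNReal.ofReal (Real.exp (β * x)) ∂compoundPoisson ν t =
      ENNReal.ofReal (Real.exp (t * laplaceExponent ν β)) := by
  have hM : ∫⁻ x, ENNReal.ofReal (Real.exp (β * x)) ∂ν =
      ENNReal.ofReal (laplaceExponent ν β + ν.real Set.univ) := by
    rw [← integral_exp_eq ν hβ, ofReal_integral_eq_lintegral_ofReal hβ
      (Eventually.of_forall fun x => (Real.exp_pos _).le)]
  have hM0 : 0 ≤ laplaceExponent ν β + ν.real Set.univ := by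
    rw [← integral_exp_eq ν hβ]
    exact integral_nonneg fun x => (Real.exp_pos _).le
  set M := laplaceExponent ν β + ν.real Set.univ with hMdef
  have hs : HasSum (fun n : ℕ => Real.exp (-(t * ν.real Set.univ)) * (t ^ n / n.factorial) * M ^ n)
      (Real.exp (t * laplaceExponent ν β)) := by
    have := (NormedSpace.expSeries_div_hasSum_exp (t * M)).mul_left
      (Real.exp (-(t * ν.real Set.univ)))
    have he : -(t * ν.real Set.univ) + t * M = t * laplaceExponent ν β := by
      rw [hMdef]
      ring
    rw [← Real.exp_eq_exp_ℝ, ← Real.exp_add, he] at this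
    have hfun : (fun n : ℕ => Real.exp (-(t * ν.real Set.univ)) * (t ^ n / n.factorial) * M ^ n) =
        fun n : ℕ => Real.exp (-(t * ν.real Set.univ)) * ((t * M) ^ n / n.factorial) := by
      funext n
      rw [mul_pow]
      ring
    rw [hfun]
    exact this
  rw [compoundPoisson, lintegral_sum_measure, ← hs.tsum_eq,
    ENNReal.ofReal_tsum_of_nonneg (fun n => by positivity) hs.summable]
  congr 1
  funext n
  rw [lintegral_smul_measure, lintegral_exp_convPow, hM, smul_eq_mul, ← ENNReal.ofReal_pow hM0,
    ← ENNReal.ofReal_mul (by positivity)]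

theorem isProbabilityMeasure_compoundPoisson (ν : Measure ℝ) [IsFiniteMeasure ν] {t : ℝ}
    (ht : 0 ≤ t) : IsProbabilityMeasure (compoundPoisson ν t) := by
  have := lintegral_exp_compoundPoisson ν ht (β := 0) (by simp)
  exact ⟨by simpa [laplaceExponent] using this⟩

theorem charFun_compoundPoisson (ν : Measure ℝ) [IsFiniteMeasure ν] {t : ℝ} (ht : 0 ≤ t) (p : ℝ) :
    charFun (compoundPoisson ν t) p =
      Complex.exp ((t : ℂ) * ∫ x, (Complex.exp (Complex.I * p * x) - 1) ∂ν) := by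
  have := isProbabilityMeasure_compoundPoisson ν ht
  have hint : ∀ μ : Measure ℝ, IsFiniteMeasure μ →
      Integrable (fun x : ℝ => Complex.exp (p * x * Complex.I)) μ := by
    intro μ _
    refine Integrable.of_bound (C := 1) (by fun_prop) (Eventually.of_forall fun x => ?_)
    rw [← Complex.ofReal_mul, Complex.norm_exp_ofReal_mul_I]
  have hexp : ∫ x, (Complex.exp (Complex.I * p * x) - 1) ∂ν = charFun ν p - ν.real Set.univ := by
    have h1 : (fun x : ℝ => Complex.exp (Complex.I * p * x) - 1) =
        fun x : ℝ => Complex.exp (p * x * Complex.I) - 1 := by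
      funext x
      ring_nf
    rw [h1, integral_sub (hint ν inferInstance) (integrable_const _), charFun_apply_real]
    simp
  have hs := hasSum_integral_measure (hint (compoundPoisson ν t) inferInstance)
  have hs' := (NormedSpace.expSeries_div_hasSum_exp ((t : ℂ) * charFun ν p)).mul_left
      (Complex.exp (-((t : ℂ) * ν.real Set.univ)))
  rw [← Complex.exp_eq_exp_ℂ, ← Complex.exp_add] at hs'
  rw [charFun_apply_real, hexp]
  refine (hs.unique (a₂ := Complex.exp (-((t : ℂ) * ν.real Set.univ) + t * charFun ν p))
    ?_).trans ?_
  · refine Eq.mp (congrArg (fun f => HasSum f _) (funext fun n => ?_)) hs'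
    rw [integral_smul_measure, ← charFun_apply_real, charFun_convPow,
      ENNReal.toReal_ofReal (by positivity), Complex.real_smul]
    push_cast
    ring
  · ring_nf

theorem eq_compoundPoisson {ν μ : Measure ℝ} [IsFiniteMeasure ν] [IsFiniteMeasure μ] {t : ℝ}
    (ht : 0 ≤ t) (hμ : ∀ p : ℝ, charFun μ p =
      Complex.exp ((t : ℂ) * ∫ x, (Complex.exp (Complex.I * p * x) - 1) ∂ν)) :
    μ = compoundPoisson ν t := by
  have := isProbabilityMeasure_compoundPoisson ν ht
  refine Measure.ext_of_charFun (funext fun p => ?_)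
  rw [hμ, charFun_compoundPoisson ν ht]

theorem ae_le_of_support_restrict_eq {ν : Measure ℝ} {h : ℝ} (hpos : 0 < h)
    (hν : (ν.restrict (Set.Ioi 0)).support = {h}) : ∀ᵐ x ∂ν, x ≤ h := by
  have h1 : ∀ᵐ x ∂(ν.restrict (Set.Ioi 0)), x = h := by
    have h2 := (ν.restrict (Set.Ioi 0)).support_mem_ae
    rw [hν] at h2
    exact h2
  rw [ae_restrict_iff' measurableSet_Ioi] at h1
  filter_upwards [h1] with x hx
  rcases le_or_gt x 0 with h0 | h0
  · linarith
  · exact (hx h0).le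

section Laplace

variable {ν : Measure ℝ} [IsFiniteMeasure ν] {h : ℝ}

theorem integrable_exp_mul (hν : ∀ᵐ x ∂ν, x ≤ h) {β : ℝ} (hβ : 0 ≤ β) :
    Integrable (fun x => Real.exp (β * x)) ν := by
  refine Integrable.of_bound (C := Real.exp (β * h)) (by fun_prop) ?_
  filter_upwards [hν] with x hx
  rw [Real.norm_eq_abs, abs_of_pos (Real.exp_pos _)]
  gcongr

theorem laplaceExponent_le (hν : ∀ᵐ x ∂ν, x ≤ h) {β : ℝ} (hβ : 0 ≤ β) :
    laplaceExponent ν β ≤ ν.real Set.univ * Real.exp (β * h) := by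
  have h1 : ∫ x, (Real.exp (β * x) - 1) ∂ν ≤ ∫ _, Real.exp (β * h) ∂ν := by
    refine integral_mono_ae ((integrable_exp_mul hν hβ).sub (integrable_const _))
      (integrable_const _) ?_
    filter_upwards [hν] with x hx
    have : Real.exp (β * x) ≤ Real.exp (β * h) := by gcongr
    linarith
  simpa [laplaceExponent] using h1

theorem laplaceExponent_largestZero (hν : ∀ᵐ x ∂ν, x ≤ h) (hpos : 0 < h)
    (hΦ : 0 < largestZero ν) : laplaceExponent ν (largestZero ν) = 0 := by
  set S := {β : ℝ | 0 ≤ β ∧ laplaceExponent ν β = 0} with hS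
  have hne : S.Nonempty := ⟨0, le_rfl, by simp [laplaceExponent]⟩
  have hbdd : BddAbove S := by
    by_contra hb
    rw [largestZero, Real.sSup_of_not_bddAbove hb] at hΦ
    exact lt_irrefl _ hΦ
  obtain ⟨u, -, hu, huS⟩ := exists_seq_tendsto_sSup hne hbdd
  have hlim : Tendsto (fun n => laplaceExponent ν (u n)) atTop
      (𝓝 (laplaceExponent ν (largestZero ν))) := by
    refine tendsto_integral_of_dominated_convergence
      (fun _ => Real.exp (largestZero ν * h) + 1) (fun n => by fun_prop) (integrable_const _)
      (fun n => ?_) (Eventually.of_forall fun x => ?_)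
    · filter_upwards [hν] with x hx
      have h1 : Real.exp (u n * x) ≤ Real.exp (largestZero ν * h) := by
        have h2 : u n ≤ largestZero ν := le_csSup hbdd (huS n)
        have h3 : u n * x ≤ u n * h := mul_le_mul_of_nonneg_left hx (huS n).1
        have h4 : u n * h ≤ largestZero ν * h := mul_le_mul_of_nonneg_right h2 hpos.le
        exact Real.exp_le_exp.2 (h3.trans h4)
      rw [Real.norm_eq_abs, abs_le]
      constructor <;> linarith [Real.exp_pos (u n * x), Real.exp_pos (largestZero ν * h)]
    · exact ((Real.continuous_exp.tendsto _).comp (hu.mul_const x)).sub_const 1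
  refine tendsto_nhds_unique hlim ?_
  simp [(huS _).2]

theorem laplaceExponent_half_neg (hν : ∀ᵐ x ∂ν, x ≤ h) (hne : ν ≠ 0) (h0 : ν {0} = 0) {c : ℝ}
    (hc : 0 < c) (hψ : laplaceExponent ν c = 0) : laplaceExponent ν (c / 2) < 0 := by
  have hi := integrable_exp_mul hν hc.le
  have hi2 := integrable_exp_mul hν (half_pos hc).le
  have hid : ∀ x, (Real.exp (c / 2 * x) - 1) ^ 2 =
      (Real.exp (c * x) - 1) - 2 * (Real.exp (c / 2 * x) - 1) := by
    intro x
    have : Real.exp (c * x) = Real.exp (c / 2 * x) ^ 2 := by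
      rw [← Real.exp_nat_mul]
      congr 1
      push_cast
      ring
    rw [this]
    ring
  have hisq : Integrable (fun x => (Real.exp (c / 2 * x) - 1) ^ 2) ν := by
    simp_rw [hid]
    exact (hi.sub (integrable_const _)).sub ((hi2.sub (integrable_const _)).const_mul 2)
  have hpos : 0 < ∫ x, (Real.exp (c / 2 * x) - 1) ^ 2 ∂ν := by
    rw [integral_pos_iff_support_of_nonneg (fun x => sq_nonneg _) hisq]
    have hsup : Function.support (fun x => (Real.exp (c / 2 * x) - 1) ^ 2) = {0}ᶜ := by
      ext x
      simp [sub_eq_zero, hc.ne']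
    rw [hsup, pos_iff_ne_zero]
    intro hz
    have : ν Set.univ = 0 := by
      rw [← Set.union_compl_self {(0 : ℝ)}]
      exact measure_union_null h0 hz
    exact hne (Measure.measure_univ_eq_zero.1 this)
  have hval : ∫ x, (Real.exp (c / 2 * x) - 1) ^ 2 ∂ν =
      laplaceExponent ν c - 2 * laplaceExponent ν (c / 2) := by
    simp_rw [hid]
    have := integral_sub (hi.sub (integrable_const (1 : ℝ)))
      ((hi2.sub (integrable_const (1 : ℝ))).const_mul 2)
    simp only [Pi.sub_apply] at this
    rw [this, integral_const_mul]
    rfl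
  linarith

end Laplace

section Chain

variable {Ω : Type*} {m : MeasurableSpace Ω} {𝓕 : Filtration ℝ≥0 m} {X : ℝ≥0 → Ω → ℝ}
  {P : Measure Ω} {h : ℝ} {ν : Measure ℝ}

theorem IsUpwardsSkipFreeLevyChain.ae_le (hX : IsUpwardsSkipFreeLevyChain 𝓕 X P h ν) :
    ∀ᵐ x ∂ν, x ≤ h :=
  ae_le_of_support_restrict_eq hX.pos hX.support_restrict_eq

theorem IsLevyProcess.measurable (hX : IsLevyProcess 𝓕 X P) (t : ℝ≥0) : Measurable (X t) :=
  (hX.adapted t).mono (𝓕.le t) le_rfl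

theorem IsUpwardsSkipFreeLevyChain.lintegral_exp (hX : IsUpwardsSkipFreeLevyChain 𝓕 X P h ν)
    {β : ℝ} (hβ : 0 ≤ β) (t : ℝ≥0) :
    ∫⁻ ω, ENNReal.ofReal (Real.exp (β * X t ω)) ∂P =
      ENNReal.ofReal (Real.exp (t * laplaceExponent ν β)) := by
  have hL := hX.isCompoundPoissonProcess.isLevyProcess
  have := hX.isCompoundPoissonProcess.isFiniteMeasure
  have := hL.isProbabilityMeasure
  have hlaw : P.map (X t) = compoundPoisson ν t :=
    eq_compoundPoisson t.2 fun p => hX.isCompoundPoissonProcess.charFun_eq t p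
  refine Eq.trans ?_ (lintegral_exp_compoundPoisson ν t.2 (integrable_exp_mul hX.ae_le hβ))
  change _ = ∫⁻ x, _ ∂compoundPoisson ν (t : ℝ)
  rw [← hlaw, lintegral_map (by fun_prop) (hL.measurable t)]

/-- Upward increments by at least two lattice steps over a time `δ` have probability
`O(δ ^ 2)`. -/
theorem IsUpwardsSkipFreeLevyChain.measure_increment_le
    (hX : IsUpwardsSkipFreeLevyChain 𝓕 X P h ν) (s : ℝ≥0) {δ : ℝ≥0} (hδ : 0 < δ) (hδ1 : δ ≤ 1) :
    P {ω | 2 * h ≤ X (s + δ) ω - X s ω} ≤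
      ENNReal.ofReal (δ ^ 2 * Real.exp (ν.real Set.univ)) := by
  have hL := hX.isCompoundPoissonProcess.isLevyProcess
  have := hX.isCompoundPoissonProcess.isFiniteMeasure
  have hpos := hX.pos
  have hδ' : (0 : ℝ) < δ := hδ
  have hδ1' : (δ : ℝ) ≤ 1 := hδ1
  have hstat : P {ω | 2 * h ≤ X (s + δ) ω - X s ω} = P {ω | 2 * h ≤ X δ ω} := by
    have h1 := congrArg (fun μ => μ (Set.Ici (2 * h))) (hL.stationary_increments s δ)
    rw [Measure.map_apply (by have := hL.measurable; fun_prop) measurableSet_Ici,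
      Measure.map_apply (hL.measurable _) measurableSet_Ici] at h1
    exact h1
  set β := -Real.log δ / h with hβdef
  have hβh : β * h = -Real.log δ := by rw [hβdef]; field_simp
  have hβ : 0 ≤ β := div_nonneg (neg_nonneg.2 (Real.log_nonpos hδ'.le hδ1')) hpos.le
  have hexp : Real.exp (β * h) = (δ : ℝ)⁻¹ := by rw [hβh, Real.exp_neg, Real.exp_log hδ']
  have hψ : δ * laplaceExponent ν β ≤ ν.real Set.univ := by
    have := laplaceExponent_le hX.ae_le hβ
    rw [hexp] at this
    calc δ * laplaceExponent ν β ≤ δ * (ν.real Set.univ * (δ : ℝ)⁻¹) := by gcongr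
      _ = ν.real Set.univ := by field_simp
  rw [hstat]
  calc P {ω | 2 * h ≤ X δ ω}
      ≤ ∫⁻ ω, ENNReal.ofReal (δ ^ 2) * ENNReal.ofReal (Real.exp (β * X δ ω)) ∂P := by
        have hA : MeasurableSet {ω | 2 * h ≤ X δ ω} := hL.measurable δ measurableSet_Ici
        rw [← lintegral_indicator_one hA]
        refine lintegral_mono fun ω => ?_
        by_cases hω : ω ∈ {ω | 2 * h ≤ X δ ω}
        swap
        · simp [Set.indicator_of_notMem hω]
        rw [Set.indicator_of_mem hω]
        rw [← ENNReal.ofReal_mul (by positivity), Pi.one_apply, ENNReal.one_le_ofReal]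
        have h2 : Real.exp (β * (2 * h)) ≤ Real.exp (β * X δ ω) := by
          have : 2 * h ≤ X δ ω := hω
          gcongr
        have h3 : Real.exp (β * (2 * h)) = ((δ : ℝ)⁻¹) ^ 2 := by
          rw [← hexp, ← Real.exp_nat_mul]
          push_cast
          ring_nf
        calc (1 : ℝ) = δ ^ 2 * ((δ : ℝ)⁻¹) ^ 2 := by field_simp
          _ ≤ δ ^ 2 * Real.exp (β * X δ ω) := by rw [← h3]; gcongr
    _ = ENNReal.ofReal (δ ^ 2 * Real.exp (δ * laplaceExponent ν β)) := by
        rw [lintegral_const_mul _ (by have := hL.measurable δ; fun_prop), hX.lintegral_exp hβ,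
          ← ENNReal.ofReal_mul (by positivity)]
    _ ≤ _ := by gcongr

end Chain

end

noncomputable section

theorem eq_of_abs_sub_lt {h a b : ℝ} (ha : a ∈ AddSubgroup.zmultiples h)
    (hb : b ∈ AddSubgroup.zmultiples h) (hab : |a - b| < h) : a = b := by
  obtain ⟨k, hk⟩ := AddSubgroup.mem_zmultiples_iff.1 (AddSubgroup.sub_mem _ ha hb)
  rw [zsmul_eq_mul] at hk
  have hpos : 0 < h := (abs_nonneg _).trans_lt hab
  rw [← hk, abs_mul, abs_of_pos hpos] at hab
  have h1 : |(k : ℝ)| < 1 := by nlinarith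
  have h2 : k = 0 := by
    rw [← Int.abs_lt_one_iff]
    exact_mod_cast h1
  rw [h2, Int.cast_zero, zero_mul] at hk
  linarith

theorem add_le_of_lt {h a b : ℝ} (ha : a ∈ AddSubgroup.zmultiples h)
    (hb : b ∈ AddSubgroup.zmultiples h) (hab : a < b) : a + h ≤ b := by
  by_contra! hlt
  refine hab.ne (eq_of_abs_sub_lt ha hb ?_)
  rw [abs_sub_comm, abs_of_pos (sub_pos.2 hab)]
  linarith

section Cadlag

variable {f g : ℝ≥0 → ℝ}

theorem IsCadlag.sub_const (hf : IsCadlag f) (a : ℝ) : IsCadlag fun t => f t - a :=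
  ⟨fun t => (hf.right_continuous t).sub continuousWithinAt_const, fun t =>
    let ⟨l, hl⟩ := hf.left_limits t
    ⟨l - a, hl.sub_const a⟩⟩

theorem IsCadlag.shift (hf : IsCadlag f) (s : ℝ≥0) : IsCadlag fun t => f (s + t) := by
  refine ⟨fun t => ?_, fun t => ?_⟩
  · refine (hf.right_continuous (s + t)).comp (t := Set.Ici (s + t)) (f := fun t => s + t) ?_ ?_
    · exact (continuous_const.add continuous_id).continuousWithinAt
    · intro u hu
      exact add_le_add_right hu s
  · obtain ⟨l, hl⟩ := hf.left_limits (s + t)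
    refine ⟨l, hl.comp (tendsto_nhdsWithin_iff.2 ⟨?_, ?_⟩)⟩
    · exact tendsto_nhdsWithin_of_tendsto_nhds ((continuous_const.add continuous_id).tendsto t)
    · filter_upwards [self_mem_nhdsWithin] with u hu
      exact add_lt_add_right hu s

/-- A càdlàg path is bounded above on every compact time interval. -/
theorem IsCadlag.bddAbove_image_Icc (hf : IsCadlag f) (t : ℝ≥0) :
    BddAbove (f '' Set.Icc 0 t) := by
  refine isCompact_Icc.induction_on (p := fun s => BddAbove (f '' s)) (by simp)
    (fun s u hsu hu => hu.mono (Set.image_mono hsu)) (fun s u hs hu => ?_) fun s _ => ?_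
  · rw [Set.image_union]
    exact hs.union hu
  · obtain ⟨l, hl⟩ := hf.left_limits s
    have h1 : ∀ᶠ u in 𝓝[<] s, f u ≤ l + 1 := by
      filter_upwards [hl (Iic_mem_nhds (lt_add_one l))] with u hu using hu
    have h2 : ∀ᶠ u in 𝓝[≥] s, f u ≤ f s + 1 := by
      filter_upwards [hf.right_continuous s (Iic_mem_nhds (lt_add_one (f s)))] with u hu using hu
    have h3 : ∀ᶠ u in 𝓝 s, f u ≤ max (l + 1) (f s + 1) := by
      rw [← nhdsLT_sup_nhdsGE, eventually_sup]
      exact ⟨h1.mono fun u hu => le_max_of_le_left hu, h2.mono fun u hu => le_max_of_le_right hu⟩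
    refine ⟨{u | f u ≤ max (l + 1) (f s + 1)}, mem_nhdsWithin_of_mem_nhds h3,
      max (l + 1) (f s + 1), ?_⟩
    rintro _ ⟨u, hu, rfl⟩
    exact hu

end Cadlag

variable {h : ℝ}

theorem measurable_pathSpace_iff {Ω : Type*} {mΩ : MeasurableSpace Ω} {f : Ω → PathSpace h} :
    Measurable f ↔ ∀ t, Measurable fun ω => coord h t (f ω) := by
  refine ⟨fun hf t => (measurable_coord h t).comp hf, fun hf => ?_⟩
  exact Measurable.subtype_mk (f := fun ω => (f ω).1) (measurable_pi_lambda _ hf)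

theorem pathSpace_ext {ω η : PathSpace h} (H : ∀ t, coord h t ω = coord h t η) : ω = η :=
  Subtype.ext (funext H)

theorem coord_mem (t : ℝ≥0) (ω : PathSpace h) : coord h t ω ∈ AddSubgroup.zmultiples h := ω.2.2 t

/-- The path stopped at the deterministic time `t`. -/
def stopAt (h : ℝ) (t : ℝ≥0) (ω : PathSpace h) : PathSpace h :=
  ⟨fun s => ω.1 (min (s : WithTop ℝ≥0) t).untopA, ω.2.1.stopped t, fun _ => ω.2.2 _⟩

@[simp]
theorem coord_stopAt (s t : ℝ≥0) (ω : PathSpace h) :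
    coord h s (stopAt h t ω) = coord h (min s t) ω := by
  change ω.1 _ = ω.1 _
  rw [← WithTop.coe_min]
  rfl

@[simp]
theorem stopAt_stopAt (t : ℝ≥0) (ω : PathSpace h) :
    stopAt h t (stopAt h t ω) = stopAt h t ω := by
  refine pathSpace_ext fun s => ?_
  simp

/-- The increments of the path after time `s`. -/
def shift (h : ℝ) (s : ℝ≥0) (ω : PathSpace h) : PathSpace h :=
  ⟨fun t => ω.1 (s + t) - ω.1 s, (ω.2.1.shift s).sub_const _,
    fun _ => AddSubgroup.sub_mem _ (ω.2.2 _) (ω.2.2 _)⟩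

@[simp]
theorem coord_shift (s t : ℝ≥0) (ω : PathSpace h) :
    coord h t (shift h s ω) = coord h (s + t) ω - coord h s ω := rfl

theorem measurable_coord_canonicalFiltration {s t : ℝ≥0} (hst : s ≤ t) :
    Measurable[canonicalFiltration h t] (coord h s) := by
  refine Measurable.of_comap_le ?_
  exact le_iSup₂ (f := fun j (_ : j ≤ t) =>
    MeasurableSpace.comap (coord h j) (inferInstance : MeasurableSpace ℝ)) s hst

theorem measurable_stopAt_canonicalFiltration (t : ℝ≥0) :
    Measurable[canonicalFiltration h t] (stopAt h t) := by
  refine (measurable_pathSpace_iff (mΩ := canonicalFiltration h t)).2 fun s => ?_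
  simp_rw [coord_stopAt]
  exact measurable_coord_canonicalFiltration (min_le_right s t)

theorem measurable_stopAt (t : ℝ≥0) : Measurable (stopAt h t) :=
  (measurable_stopAt_canonicalFiltration t).mono ((canonicalFiltration h).le t) le_rfl

theorem measurable_shift (s : ℝ≥0) : Measurable (shift h s) := by
  refine measurable_pathSpace_iff.2 fun t => ?_
  simp_rw [coord_shift]
  exact (measurable_coord h _).sub (measurable_coord h _)

theorem canonicalFiltration_le_comap (t : ℝ≥0) :
    canonicalFiltration h t ≤ MeasurableSpace.comap (stopAt h t) inferInstance := by
  refine iSup₂_le fun s hs => ?_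
  have hcomp : coord h s = coord h s ∘ stopAt h t := by
    funext ω
    simp [min_eq_left hs]
  rw [hcomp, ← MeasurableSpace.comap_comp]
  exact MeasurableSpace.comap_mono (measurable_coord h s).comap_le

/-- An event belongs to `𝓕_t` if and only if it is measurable and depends on the path only through
its restriction to `[0, t]`. -/
theorem measurableSet_canonicalFiltration_iff {t : ℝ≥0} {Λ : Set (PathSpace h)} :
    MeasurableSet[canonicalFiltration h t] Λ ↔ MeasurableSet Λ ∧ stopAt h t ⁻¹' Λ = Λ := by
  constructor
  · intro hΛ
    refine ⟨(canonicalFiltration h).le t _ hΛ, ?_⟩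
    obtain ⟨B, -, rfl⟩ := canonicalFiltration_le_comap t _ hΛ
    ext ω
    simp
  · rintro ⟨hΛ, hinv⟩
    rw [← hinv]
    exact measurable_stopAt_canonicalFiltration t hΛ

/-- A lattice-valued right-continuous path is locally constant to the right. -/
theorem eventually_coord_eq (hpos : 0 < h) (ω : PathSpace h) (t : ℝ≥0) :
    ∀ᶠ s in 𝓝[≥] t, coord h s ω = coord h t ω := by
  have h1 := ω.2.1.right_continuous t (Metric.ball_mem_nhds _ hpos)
  filter_upwards [h1] with s hs
  exact eq_of_abs_sub_lt (coord_mem s ω) (coord_mem t ω) hs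

theorem exists_gt_coord_eq (hpos : 0 < h) (ω : PathSpace h) (t : ℝ≥0) :
    ∃ u > t, ∀ s, t ≤ s → s < u → coord h s ω = coord h t ω := by
  obtain ⟨u, hu, hsub⟩ := mem_nhdsGE_iff_exists_Ico_subset.1 (eventually_coord_eq hpos ω t)
  exact ⟨u, hu, fun s hs hsu => hsub ⟨hs, hsu⟩⟩

/-- The index of the first dyadic time of mesh `2⁻ᵐ` that is at least `t`. -/
def gridIndex (m : ℕ) (t : ℝ≥0) : ℕ := ⌈t * 2 ^ m⌉₊

/-- The dyadic time with index `k` on the grid of mesh `2⁻ᵐ`. -/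
def gridTime (m k : ℕ) : ℝ≥0 := k / 2 ^ m

theorem le_gridTime_gridIndex (m : ℕ) (t : ℝ≥0) : t ≤ gridTime m (gridIndex m t) := by
  rw [gridTime, le_div_iff₀ (by positivity)]
  exact Nat.le_ceil _

theorem gridTime_gridIndex_le (m : ℕ) (t : ℝ≥0) :
    gridTime m (gridIndex m t) ≤ t + (1 / 2) ^ m := by
  rw [gridTime, div_le_iff₀ (by positivity), add_mul, ← mul_pow]
  simpa [gridIndex] using (Nat.ceil_lt_add_one (zero_le (a := t * 2 ^ m))).le

theorem gridIndex_le_iff (m k : ℕ) (t : ℝ≥0) : gridIndex m t ≤ k ↔ t ≤ gridTime m k := by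
  rw [gridIndex, Nat.ceil_le, gridTime, le_div_iff₀ (by positivity)]

theorem gridTime_succ (m k : ℕ) : gridTime m (k + 1) = gridTime m k + (1 / 2) ^ m := by
  simp [gridTime, add_div]

theorem gridTime_mono (m : ℕ) : Monotone (gridTime m) := by
  intro k l hkl
  unfold gridTime
  gcongr

theorem tendsto_gridTime_gridIndex (t : ℝ≥0) :
    Tendsto (fun m => gridTime m (gridIndex m t)) atTop (𝓝[≥] t) := by
  refine tendsto_nhdsWithin_iff.2 ⟨?_, Eventually.of_forall fun m => le_gridTime_gridIndex m t⟩
  refine tendsto_of_tendsto_of_tendsto_of_le_of_le tendsto_const_nhds ?_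
    (fun m => le_gridTime_gridIndex m t) (fun m => gridTime_gridIndex_le m t)
  have : Tendsto (fun m : ℕ => ((1 : ℝ≥0) / 2) ^ m) atTop (𝓝 0) :=
    tendsto_pow_atTop_nhds_zero_of_lt_one zero_le (NNReal.half_lt_self one_ne_zero)
  simpa using this.const_add t

theorem eventually_coord_gridTime_eq (hpos : 0 < h) (ω : PathSpace h) (t : ℝ≥0) :
    ∀ᶠ m in atTop, coord h (gridTime m (gridIndex m t)) ω = coord h t ω :=
  (tendsto_gridTime_gridIndex t).eventually (eventually_coord_eq hpos ω t)

theorem measurable_coord_comp (hpos : 0 < h) {v : PathSpace h → ℝ≥0} (hv : Measurable v) :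
    Measurable fun ω => coord h (v ω) ω := by
  refine measurable_of_tendsto_metrizable
    (f := fun m ω => coord h (gridTime m (gridIndex m (v ω))) ω) (fun m => ?_) ?_
  · have h1 : Measurable fun p : ℕ × PathSpace h => coord h (gridTime m p.1) p.2 :=
      measurable_from_prod_countable_right fun k => measurable_coord h (gridTime m k)
    have h2 : Measurable fun ω => (gridIndex m (v ω), ω) := by
      refine Measurable.prodMk ?_ measurable_id
      exact Nat.measurable_ceil.comp (hv.mul_const _)
    exact h1.comp h2
  · rw [tendsto_pi_nhds]
    intro ω
    exact tendsto_const_nhds.congr' ((eventually_coord_gridTime_eq hpos ω (v ω)).mono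
      fun m hm => hm.symm)

section Entrance

variable {x : ℝ}

theorem entranceTime_lt_top_iff {ω : PathSpace h} :
    entranceTime h x ω < ⊤ ↔ ∃ s, x ≤ coord h s ω := by
  rw [lt_top_iff_ne_top, entranceTime, Ne, hittingAfter_eq_top_iff]
  push Not
  simp

theorem entranceTime_eq_coe_iff (hpos : 0 < h) {ω : PathSpace h} {τ : ℝ≥0} :
    entranceTime h x ω = τ ↔ x ≤ coord h τ ω ∧ ∀ s < τ, coord h s ω < x := by
  have key : ∀ σ : ℝ≥0, entranceTime h x ω = σ →
      x ≤ coord h σ ω ∧ ∀ s < σ, coord h s ω < x := by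
    intro σ hσ
    refine ⟨?_, fun s hs => ?_⟩
    · have hex : ∃ j, (0 : ℝ≥0) ≤ j ∧ coord h j ω ∈ Set.Ici x := by
        obtain ⟨s, hs⟩ := entranceTime_lt_top_iff.1 (hσ ▸ WithTop.coe_lt_top σ)
        exact ⟨s, zero_le, hs⟩
      have hσ' : sInf {i : ℝ≥0 | 0 ≤ i ∧ coord h i ω ∈ Set.Ici x} = σ := by
        rw [entranceTime, hittingAfter, if_pos hex] at hσ
        exact WithTop.coe_injective hσ
      obtain ⟨u, hu, hconst⟩ := exists_gt_coord_eq hpos ω σ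
      rw [← hσ'] at hu
      obtain ⟨a, ha, hau⟩ := exists_lt_of_csInf_lt hex hu
      have hσa : σ ≤ a := hσ' ▸ csInf_le (OrderBot.bddBelow _) ha
      rw [← hconst a hσa hau]
      exact ha.2
    · have := notMem_of_lt_hittingAfter (u := coord h) (s := Set.Ici x) (n := 0) (ω := ω) (k := s)
        (by change (s : WithTop ℝ≥0) < entranceTime h x ω; rw [hσ]; exact_mod_cast hs) zero_le
      simpa using this
  refine ⟨key τ, fun ⟨h1, h2⟩ => ?_⟩
  obtain ⟨σ, hσ⟩ := WithTop.ne_top_iff_exists.1 (entranceTime_lt_top_iff.2 ⟨τ, h1⟩).ne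
  obtain ⟨h3, h4⟩ := key σ hσ.symm
  rw [← hσ]
  congr 1
  refine le_antisymm ?_ ?_
  · by_contra! hlt
    exact absurd (h4 τ hlt) (not_lt.2 h1)
  · by_contra! hlt
    exact absurd (h2 σ hlt) (not_lt.2 h3)

theorem entranceTime_le_coe_iff (hpos : 0 < h) {ω : PathSpace h} {t : ℝ≥0} :
    entranceTime h x ω ≤ t ↔ ∃ s ≤ t, x ≤ coord h s ω := by
  constructor
  · intro hle
    obtain ⟨σ, hσ⟩ := WithTop.ne_top_iff_exists.1 (hle.trans_lt (WithTop.coe_lt_top t)).ne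
    refine ⟨σ, ?_, ((entranceTime_eq_coe_iff hpos).1 hσ.symm).1⟩
    rw [← hσ] at hle
    exact_mod_cast hle
  · rintro ⟨s, hst, hs⟩
    obtain ⟨σ, hσ⟩ := WithTop.ne_top_iff_exists.1 (entranceTime_lt_top_iff.2 ⟨s, hs⟩).ne
    have h4 := ((entranceTime_eq_coe_iff hpos).1 hσ.symm).2
    have hσs : σ ≤ s := by
      by_contra! hlt
      exact absurd (h4 s hlt) (not_lt.2 hs)
    rw [← hσ]
    exact_mod_cast hσs.trans hst

theorem entranceTime_stopAt (hpos : 0 < h) {ω : PathSpace h} {t : ℝ≥0}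
    (hle : entranceTime h x ω ≤ t) : entranceTime h x (stopAt h t ω) = entranceTime h x ω := by
  obtain ⟨σ, hσ⟩ := WithTop.ne_top_iff_exists.1 (hle.trans_lt (WithTop.coe_lt_top t)).ne
  have hσt : σ ≤ t := by
    rw [← hσ] at hle
    exact_mod_cast hle
  obtain ⟨h1, h2⟩ := (entranceTime_eq_coe_iff hpos).1 hσ.symm
  rw [← hσ, entranceTime_eq_coe_iff hpos]
  simp only [coord_stopAt]
  refine ⟨by rwa [min_eq_left hσt], fun s hs => ?_⟩
  rw [min_eq_left (hs.le.trans hσt)]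
  exact h2 s hs

theorem entranceTime_stopAt_le_iff (hpos : 0 < h) {ω : PathSpace h} {t : ℝ≥0} :
    entranceTime h x (stopAt h t ω) ≤ t ↔ entranceTime h x ω ≤ t := by
  simp only [entranceTime_le_coe_iff hpos, coord_stopAt]
  exact exists_congr fun s => and_congr_right fun hs => by rw [min_eq_left hs]

theorem measurableSet_entranceTime_le (hpos : 0 < h) (t : ℝ≥0) :
    MeasurableSet {ω | entranceTime h x ω ≤ t} := by
  have heq : {ω | entranceTime h x ω ≤ t} = {ω : PathSpace h | x ≤ coord h t ω} ∪
      ⋃ n : ℕ, {ω : PathSpace h | TopologicalSpace.denseSeq ℝ≥0 n ≤ t ∧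
        x ≤ coord h (TopologicalSpace.denseSeq ℝ≥0 n) ω} := by
    ext ω
    simp only [Set.mem_ofPred_eq, Set.mem_union, Set.mem_iUnion, entranceTime_le_coe_iff hpos]
    constructor
    · rintro ⟨s, hst, hs⟩
      rcases hst.eq_or_lt with rfl | hlt
      · exact Or.inl hs
      obtain ⟨u, hu, hconst⟩ := exists_gt_coord_eq hpos ω s
      obtain ⟨_, ⟨n, rfl⟩, hn⟩ := (TopologicalSpace.denseRange_denseSeq ℝ≥0).exists_between
        (lt_min hlt hu)
      refine Or.inr ⟨n, (hn.2.trans_le (min_le_left _ _)).le, ?_⟩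
      rwa [hconst _ hn.1.le (hn.2.trans_le (min_le_right _ _))]
    · rintro (hs | ⟨n, hn, hs⟩)
      · exact ⟨t, le_rfl, hs⟩
      · exact ⟨_, hn, hs⟩
  rw [heq]
  refine (measurableSet_le measurable_const (measurable_coord h t)).union
    (MeasurableSet.iUnion fun n => ?_)
  exact (MeasurableSet.const _).inter (measurableSet_le measurable_const (measurable_coord h _))

theorem measurableSet_entranceTime_lt_top (hpos : 0 < h) :
    MeasurableSet {ω | entranceTime h x ω < ⊤} := by
  have heq : {ω | entranceTime h x ω < ⊤} =
      ⋃ n : ℕ, {ω : PathSpace h | entranceTime h x ω ≤ (n : ℝ≥0)} := by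
    ext ω
    simp only [Set.mem_ofPred_eq, Set.mem_iUnion, entranceTime_lt_top_iff,
      entranceTime_le_coe_iff hpos]
    constructor
    · rintro ⟨s, hs⟩
      obtain ⟨n, hn⟩ := exists_nat_ge s
      exact ⟨n, s, hn, hs⟩
    · rintro ⟨n, s, -, hs⟩
      exact ⟨s, hs⟩
  rw [heq]
  exact MeasurableSet.iUnion fun n => measurableSet_entranceTime_le hpos _

/-- The first entrance time as a real number, with value `0` when it is infinite. -/
def entranceTimeReal (h x : ℝ) (ω : PathSpace h) : ℝ≥0 := (entranceTime h x ω).untopD 0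

theorem coe_entranceTimeReal {ω : PathSpace h} (hω : entranceTime h x ω < ⊤) :
    (entranceTimeReal h x ω : WithTop ℝ≥0) = entranceTime h x ω := by
  obtain ⟨σ, hσ⟩ := WithTop.ne_top_iff_exists.1 hω.ne
  rw [entranceTimeReal, ← hσ]
  rfl

theorem measurable_entranceTimeReal (hpos : 0 < h) : Measurable (entranceTimeReal h x) := by
  refine measurable_of_Iic fun t => ?_
  have heq : entranceTimeReal h x ⁻¹' Set.Iic t =
      {ω | entranceTime h x ω ≤ t} ∪ {ω | entranceTime h x ω < ⊤}ᶜ := by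
    ext ω
    by_cases hω : entranceTime h x ω < ⊤
    · have h1 : entranceTimeReal h x ω ≤ t ↔ entranceTime h x ω ≤ t := by
        rw [← coe_entranceTimeReal hω]
        exact WithTop.coe_le_coe.symm
      simp [h1, hω]
    · have htop : entranceTime h x ω = ⊤ := not_lt_top_iff.1 hω
      simp [entranceTimeReal, htop]
  rw [heq]
  exact (measurableSet_entranceTime_le hpos t).union (measurableSet_entranceTime_lt_top hpos).compl

theorem coord_stoppedPath_of_le {ω : PathSpace h} {s : ℝ≥0} (hω : entranceTime h x ω ≤ s) :
    coord h s (stoppedPath h x ω) = coord h (entranceTimeReal h x ω) ω := by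
  change coord h (min (s : WithTop ℝ≥0) (entranceTime h x ω)).untopA ω = _
  rw [min_eq_right hω, ← coe_entranceTimeReal (hω.trans_lt (WithTop.coe_lt_top s))]
  rfl

theorem coord_stoppedPath_of_ge {ω : PathSpace h} {s : ℝ≥0} (hω : s ≤ entranceTime h x ω) :
    coord h s (stoppedPath h x ω) = coord h s ω := by
  change coord h (min (s : WithTop ℝ≥0) (entranceTime h x ω)).untopA ω = _
  rw [min_eq_left hω]
  rfl

theorem measurable_stoppedPath (hpos : 0 < h) : Measurable (stoppedPath h x) := by
  classical
  refine measurable_pathSpace_iff.2 fun s => ?_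
  have heq : (fun ω => coord h s (stoppedPath h x ω)) = fun ω =>
      coord h (if entranceTime h x ω ≤ s then entranceTimeReal h x ω else s) ω := by
    funext ω
    split_ifs with hω
    · exact coord_stoppedPath_of_le hω
    · exact coord_stoppedPath_of_ge (not_le.1 hω).le
  rw [heq]
  exact measurable_coord_comp hpos (Measurable.ite (measurableSet_entranceTime_le hpos s)
    (measurable_entranceTimeReal hpos) measurable_const)

theorem stoppedPath_stopAt (hpos : 0 < h) {ω : PathSpace h} {t : ℝ≥0}
    (hle : entranceTime h x ω ≤ t) : stoppedPath h x (stopAt h t ω) = stoppedPath h x ω := by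
  have hT := entranceTime_stopAt hpos hle
  have hlt := hle.trans_lt (WithTop.coe_lt_top t)
  have hcoe := coe_entranceTimeReal hlt
  have hσ : entranceTimeReal h x ω ≤ t := by
    rw [← hcoe] at hle
    exact_mod_cast hle
  refine pathSpace_ext fun s => ?_
  rcases le_total (entranceTime h x ω) s with hs | hs
  · rw [coord_stoppedPath_of_le hs, coord_stoppedPath_of_le (hT.le.trans hs), coord_stopAt,
      entranceTimeReal, hT]
    change coord h (min (entranceTimeReal h x ω) t) ω = _
    rw [min_eq_left hσ]
  · rw [coord_stoppedPath_of_ge hs, coord_stoppedPath_of_ge (hs.trans hT.ge), coord_stopAt]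
    have : s ≤ t := by exact_mod_cast hs.trans hle
    rw [min_eq_left this]

/-- `Λ` belongs to the σ-algebra of events observed up to the first entrance time. -/
def IsObserved (h x : ℝ) (Λ : Set (PathSpace h)) : Prop :=
  MeasurableSet Λ ∧
    ∀ t : ℝ≥0, MeasurableSet[canonicalFiltration h t] (Λ ∩ {ω | entranceTime h x ω ≤ t})

theorem measurableSet_canonicalFiltration_entranceTime_le (hpos : 0 < h) (t : ℝ≥0) :
    MeasurableSet[canonicalFiltration h t] {ω | entranceTime h x ω ≤ t} := by
  refine measurableSet_canonicalFiltration_iff.2 ⟨measurableSet_entranceTime_le hpos t, ?_⟩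
  ext ω
  exact entranceTime_stopAt_le_iff hpos

theorem IsObserved.preimage_stoppedPath (hpos : 0 < h) {B : Set (PathSpace h)}
    (hB : MeasurableSet B) : IsObserved h x (stoppedPath h x ⁻¹' B) := by
  refine ⟨measurable_stoppedPath hpos hB, fun t => ?_⟩
  refine measurableSet_canonicalFiltration_iff.2
    ⟨(measurable_stoppedPath hpos hB).inter (measurableSet_entranceTime_le hpos t), ?_⟩
  ext ω
  simp only [Set.mem_preimage, Set.mem_inter_iff, Set.mem_ofPred_eq]
  rw [entranceTime_stopAt_le_iff hpos]
  refine and_congr_left fun hω => ?_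
  rw [stoppedPath_stopAt hpos hω]

theorem IsObserved.inter_entranceTime_gt (hpos : 0 < h) {t : ℝ≥0} {Λ : Set (PathSpace h)}
    (hΛ : MeasurableSet[canonicalFiltration h t] Λ) :
    IsObserved h x (Λ ∩ {ω | entranceTime h x ω ≤ t}ᶜ) := by
  refine ⟨((canonicalFiltration h).le t _ hΛ).inter
    (measurableSet_entranceTime_le hpos t).compl, fun s => ?_⟩
  rcases le_total s t with hst | hst
  · have hempty : Λ ∩ {ω | entranceTime h x ω ≤ t}ᶜ ∩ {ω | entranceTime h x ω ≤ s} = ∅ := by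
      ext ω
      simp only [Set.mem_inter_iff, Set.mem_compl_iff, Set.mem_ofPred_eq, Set.mem_empty_iff_false,
        iff_false]
      rintro ⟨⟨-, h1⟩, h2⟩
      exact h1 (h2.trans (by exact_mod_cast hst))
    rw [hempty]
    exact MeasurableSpace.measurableSet_empty _
  · have hmono := (canonicalFiltration h).mono hst
    exact @MeasurableSet.inter _ (canonicalFiltration h s) _ _
      (@MeasurableSet.inter _ (canonicalFiltration h s) _ _ (hmono _ hΛ)
        (@MeasurableSet.compl _ _ (canonicalFiltration h s)
          (hmono _ (measurableSet_canonicalFiltration_entranceTime_le hpos t))))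
      (measurableSet_canonicalFiltration_entranceTime_le hpos s)

theorem IsObserved.entranceTime_le (hpos : 0 < h) (t : ℝ≥0) :
    IsObserved h x {ω | entranceTime h x ω ≤ t} := by
  refine ⟨measurableSet_entranceTime_le hpos t, fun s => ?_⟩
  have heq : {ω | entranceTime h x ω ≤ t} ∩ {ω | entranceTime h x ω ≤ s} =
      {ω | entranceTime h x ω ≤ (min t s : ℝ≥0)} := by
    ext ω
    simp only [Set.mem_inter_iff, Set.mem_ofPred_eq, WithTop.coe_min]
    exact le_min_iff.symm
  rw [heq]
  exact (canonicalFiltration h).mono (min_le_right t s) _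
    (measurableSet_canonicalFiltration_entranceTime_le hpos _)

/-- The path enters `[n h, ∞)` if and only if its overall supremum is at least `n h`. -/
theorem le_overallSup_iff (hpos : 0 < h) (n : ℕ) (ω : PathSpace h) :
    (((n : ℝ) * h : ℝ) : EReal) ≤ overallSup ω ↔ entranceTime h (n * h) ω < ⊤ := by
  rw [entranceTime_lt_top_iff]
  constructor
  · intro hle
    by_contra! hlt
    have hn : (n : ℝ) * h ∈ AddSubgroup.zmultiples h :=
      AddSubgroup.mem_zmultiples_iff.2 ⟨n, by simp⟩
    have hsup : overallSup ω ≤ (((n : ℝ) * h - h : ℝ) : EReal) := by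
      refine iSup_le fun t => ?_
      have := add_le_of_lt (coord_mem t ω) hn (hlt t)
      exact_mod_cast (by linarith : coord h t ω ≤ (n : ℝ) * h - h)
    have := hle.trans hsup
    have h2 : (n : ℝ) * h ≤ n * h - h := by exact_mod_cast this
    linarith
  · rintro ⟨s, hs⟩
    exact le_trans (by exact_mod_cast hs) (le_iSup (fun t : ℝ≥0 => (coord h t ω : EReal)) s)

theorem iInter_entranceTime_le_eq_empty (hpos : 0 < h) (t : ℝ≥0) :
    ⋂ n : ℕ, {ω : PathSpace h | entranceTime h (n * h) ω ≤ t} = ∅ := by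
  ext ω
  simp only [Set.mem_iInter, Set.mem_ofPred_eq, entranceTime_le_coe_iff hpos,
    Set.mem_empty_iff_false, iff_false]
  push Not
  obtain ⟨M, hM⟩ := ω.2.1.bddAbove_image_Icc t
  obtain ⟨n, hn⟩ := exists_nat_gt (M / h)
  refine ⟨n, fun s hs => ?_⟩
  have h1 : coord h s ω ≤ M := hM ⟨s, ⟨zero_le, hs⟩, rfl⟩
  rw [div_lt_iff₀ hpos] at hn
  linarith

theorem antitone_entranceTime_le (hpos : 0 < h) (t : ℝ≥0) :
    Antitone fun n : ℕ => {ω : PathSpace h | entranceTime h (n * h) ω ≤ t} := by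
  intro n k hnk ω hω
  simp only [Set.mem_ofPred_eq, entranceTime_le_coe_iff hpos] at hω ⊢
  obtain ⟨s, hs, hsx⟩ := hω
  refine ⟨s, hs, le_trans ?_ hsx⟩
  gcongr

end Entrance

end

noncomputable section

/-- The smallest lattice point that is at least `x`. -/
def latticeCeil (h x : ℝ) : ℝ := ⌈x / h⌉ * h

theorem latticeCeil_mem (h x : ℝ) : latticeCeil h x ∈ AddSubgroup.zmultiples h :=
  AddSubgroup.mem_zmultiples_iff.2 ⟨⌈x / h⌉, by simp [latticeCeil]⟩

theorem le_latticeCeil {h : ℝ} (hpos : 0 < h) (x : ℝ) : x ≤ latticeCeil h x := by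
  rw [latticeCeil, ← div_le_iff₀ hpos]
  exact Int.le_ceil _

theorem latticeCeil_le_iff {h : ℝ} (hpos : 0 < h) {x v : ℝ} (hv : v ∈ AddSubgroup.zmultiples h) :
    latticeCeil h x ≤ v ↔ x ≤ v := by
  obtain ⟨k, rfl⟩ := AddSubgroup.mem_zmultiples_iff.1 hv
  rw [latticeCeil, zsmul_eq_mul, mul_le_mul_iff_left₀ hpos, Int.cast_le, Int.ceil_le,
    div_le_iff₀ hpos]

variable {h : ℝ} {ν : Measure ℝ} {P : Measure (PathSpace h)}

/-- The event that some increment over the dyadic grid of mesh `2⁻ᵐ` on `[0, N]` is at least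
two lattice steps. -/
def bigStep (h : ℝ) (N m : ℕ) : Set (PathSpace h) :=
  ⋃ k ∈ Finset.range (N * 2 ^ m),
    {ω | 2 * h ≤ coord h (gridTime m k + (1 / 2) ^ m) ω - coord h (gridTime m k) ω}

theorem measure_bigStep_le
    (hX : IsUpwardsSkipFreeLevyChain (canonicalFiltration h) (coord h) P h ν) (N m : ℕ) :
    P (bigStep h N m) ≤ ENNReal.ofReal (N * Real.exp (ν.real Set.univ) * (1 / 2) ^ m) := by
  have hδ : (0 : ℝ≥0) < (1 / 2) ^ m := by positivity
  have hδ1 : ((1 : ℝ≥0) / 2) ^ m ≤ 1 := pow_le_one₀ zero_le (NNReal.half_le_self 1)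
  refine (measure_biUnion_finset_le _ _).trans ?_
  refine (Finset.sum_le_sum fun k _ => hX.measure_increment_le (gridTime m k) hδ hδ1).trans ?_
  rw [Finset.sum_const, Finset.card_range, nsmul_eq_mul, ← ENNReal.ofReal_natCast,
    ← ENNReal.ofReal_mul (by positivity)]
  refine ENNReal.ofReal_le_ofReal (le_of_eq ?_)
  push_cast
  have h2 : (2 : ℝ) ^ m * (1 / 2) ^ m = 1 := by
    rw [← mul_pow]
    norm_num
  calc (N : ℝ) * 2 ^ m * (((1 / 2) ^ m) ^ 2 * Real.exp (ν.real Set.univ))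
      = (N : ℝ) * Real.exp (ν.real Set.univ) * (1 / 2) ^ m * (2 ^ m * (1 / 2) ^ m) := by ring
    _ = _ := by rw [h2, mul_one]

theorem ae_eventually_notMem_bigStep
    (hX : IsUpwardsSkipFreeLevyChain (canonicalFiltration h) (coord h) P h ν) :
    ∀ᵐ ω ∂P, ∀ N : ℕ, ∀ᶠ m in atTop, ω ∉ bigStep h N m := by
  rw [ae_all_iff]
  intro N
  refine ae_eventually_notMem (ne_top_of_le_ne_top ?_
    (ENNReal.tsum_le_tsum fun m => measure_bigStep_le hX N m))
  refine Summable.tsum_ofReal_ne_top ?_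
  exact (summable_geometric_of_lt_one (by norm_num) (by norm_num)).mul_left _

theorem eventually_mem_bigStep (hpos : 0 < h) {x : ℝ} {ω : PathSpace h} {τ : ℝ≥0}
    (hτ : entranceTime h x ω = τ) (hτ0 : 0 < τ) (hjump : latticeCeil h x + h ≤ coord h τ ω)
    {N : ℕ} (hN : τ ≤ N) : ∀ᶠ m in atTop, ω ∈ bigStep h N m := by
  filter_upwards [eventually_coord_gridTime_eq hpos ω τ] with m hm
  obtain ⟨k, hk⟩ : ∃ k, gridIndex m τ = k + 1 := by
    refine Nat.exists_eq_succ_of_ne_zero fun h0 => ?_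
    have := (gridIndex_le_iff m 0 τ).1 h0.le
    simp only [gridTime, Nat.cast_zero, zero_div] at this
    exact absurd this (not_le.2 hτ0)
  have hkτ : gridTime m k < τ := by
    rw [← not_le, ← gridIndex_le_iff, hk]
    omega
  have hkN : k + 1 ≤ N * 2 ^ m := by
    rw [← hk, gridIndex_le_iff]
    simpa [gridTime] using hN
  have hlow := ((entranceTime_eq_coe_iff hpos).1 hτ).2 _ hkτ
  have hlow' : coord h (gridTime m k) ω + h ≤ latticeCeil h x :=
    add_le_of_lt (coord_mem _ ω) (latticeCeil_mem h x) (hlow.trans_le (le_latticeCeil hpos x))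
  rw [hk, gridTime_succ] at hm
  refine Set.mem_biUnion (x := k) (by simpa using hkN) ?_
  rw [Set.mem_ofPred_eq, hm]
  linarith

/-- The chain enters `[x, ∞)` at the smallest lattice point of that set. -/
theorem ae_coord_entranceTime_eq
    (hX : IsUpwardsSkipFreeLevyChain (canonicalFiltration h) (coord h) P h ν) {x : ℝ}
    (hx : 0 ≤ x) : ∀ᵐ ω ∂P, entranceTime h x ω < ⊤ →
      coord h (entranceTimeReal h x ω) ω = latticeCeil h x := by
  have hpos := hX.pos
  filter_upwards [ae_eventually_notMem_bigStep hX,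
    hX.isCompoundPoissonProcess.isLevyProcess.zero] with ω hω hω0 hlt
  have hτ := (coe_entranceTimeReal hlt).symm
  set τ := entranceTimeReal h x ω
  have hle := ((entranceTime_eq_coe_iff hpos).1 hτ).1
  have hle' := (latticeCeil_le_iff hpos (coord_mem τ ω)).2 hle
  rcases hle'.eq_or_lt with heq | hgt
  · exact heq.symm
  exfalso
  have hjump := add_le_of_lt (latticeCeil_mem h x) (coord_mem τ ω) hgt
  rcases eq_or_ne τ 0 with h0 | h0
  · rw [h0, hω0] at hgt
    linarith [le_latticeCeil hpos x]
  · obtain ⟨N, hN⟩ := exists_nat_ge τ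
    obtain ⟨m, hm1, hm2⟩ := ((hω N).and
      (eventually_mem_bigStep hpos hτ (pos_iff_ne_zero.2 h0) hjump hN)).exists
    exact hm1 hm2

end

noncomputable section

variable {h : ℝ}

section FiniteDimensional

open Classical in
/-- The values of a path at the times in `I`, completed by zeros. -/
def sampleAt (h : ℝ) (I : Finset ℝ≥0) (ω : PathSpace h) : ℝ≥0 → ℝ :=
  fun t => if t ∈ I then coord h t ω else 0

theorem measurable_sampleAt {I : Finset ℝ≥0} {t : ℝ≥0} (hI : ∀ s ∈ I, s ≤ t) :
    Measurable[canonicalFiltration h t] (sampleAt h I) := by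
  refine @measurable_pi_lambda _ _ _ (canonicalFiltration h t) _ _ fun s => ?_
  unfold sampleAt
  split_ifs with hs
  · exact measurable_coord_canonicalFiltration (hI s hs)
  · exact measurable_const

theorem map_eq_of_forall_sampleAt {μ₁ μ₂ : Measure (PathSpace h)} [IsFiniteMeasure μ₁]
    [IsFiniteMeasure μ₂]
    (H : ∀ I : Finset ℝ≥0, μ₁.map (sampleAt h I) = μ₂.map (sampleAt h I)) : μ₁ = μ₂ := by
  have hval : Measurable fun ω : PathSpace h => ω.1 := measurable_subtype_coe
  have hlim : ∀ (μ : Measure (PathSpace h)) (I : Finset ℝ≥0),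
      (μ.map fun ω : PathSpace h => ω.1).map I.restrict =
        (μ.map (sampleAt h I)).map I.restrict := by
    intro μ I
    have hs : Measurable (sampleAt h I) :=
      (measurable_sampleAt (t := I.sup id) fun s hs => Finset.le_sup (f := id) hs).mono
        ((canonicalFiltration h).le _) le_rfl
    rw [Measure.map_map (Finset.measurable_restrict I) hval,
      Measure.map_map (Finset.measurable_restrict I) hs]
    congr 1
    funext ω i
    simp [sampleAt, coord]
  have hmap : (μ₁.map fun ω : PathSpace h => ω.1) = μ₂.map fun ω : PathSpace h => ω.1 := by
    refine IsProjectiveLimit.unique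
      (P := fun I : Finset ℝ≥0 => (μ₂.map fun ω : PathSpace h => ω.1).map I.restrict) ?_ ?_
    · intro I
      change Measure.map I.restrict _ = Measure.map I.restrict _
      rw [hlim μ₁ I, hlim μ₂ I, H]
    · intro I
      rfl
  ext B hB
  obtain ⟨B', hB', rfl⟩ := hB
  have := congrArg (fun μ => μ B') hmap
  simpa only [Measure.map_apply hval hB'] using this

/-- Two finite measures of equal mass under which the coordinate process starts at `0` and has
independent increments with the same laws `p` coincide. -/
theorem eq_of_independent_increments {μ₁ μ₂ : Measure (PathSpace h)} [IsFiniteMeasure μ₁]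
    [IsFiniteMeasure μ₂] {p : ℝ≥0 → Measure ℝ} [∀ v, IsFiniteMeasure (p v)]
    (h₁ : ∀ u v E A, MeasurableSet[canonicalFiltration h u] E → MeasurableSet A →
      μ₁ (E ∩ {ω | coord h (u + v) ω - coord h u ω ∈ A}) = μ₁ E * p v A)
    (h₂ : ∀ u v E A, MeasurableSet[canonicalFiltration h u] E → MeasurableSet A →
      μ₂ (E ∩ {ω | coord h (u + v) ω - coord h u ω ∈ A}) = μ₂ E * p v A)
    (hz₁ : ∀ᵐ ω ∂μ₁, coord h 0 ω = 0) (hz₂ : ∀ᵐ ω ∂μ₂, coord h 0 ω = 0)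
    (huniv : μ₁ Set.univ = μ₂ Set.univ) : μ₁ = μ₂ := by
  classical
  have hmeas : ∀ I : Finset ℝ≥0, Measurable (sampleAt h I) := fun I =>
    (measurable_sampleAt (t := I.sup id) fun s hs => Finset.le_sup (f := id) hs).mono
      ((canonicalFiltration h).le _) le_rfl
  have key : ∀ I : Finset ℝ≥0,
      μ₁.map (sampleAt h (insert 0 I)) = μ₂.map (sampleAt h (insert 0 I)) := by
    intro I
    induction I using Finset.induction_on_max with
    | empty =>
      have hconst : ∀ μ : Measure (PathSpace h), (∀ᵐ ω ∂μ, coord h 0 ω = 0) →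
          μ.map (sampleAt h (insert 0 ∅)) = μ Set.univ • Measure.dirac 0 := by
        intro μ hμ
        have : sampleAt h (insert 0 ∅) =ᵐ[μ] fun _ => 0 := by
          filter_upwards [hμ] with ω hω
          funext t
          by_cases ht : t = 0 <;> simp [sampleAt, ht, hω]
        rw [Measure.map_congr this, Measure.map_const]
      rw [hconst μ₁ hz₁, hconst μ₂ hz₂, huniv]
    | insert a I hI ih =>
      set J := insert 0 I with hJ
      have hJne : J.Nonempty := ⟨0, by simp [hJ]⟩
      set u := J.max' hJne with hu
      have huJ : u ∈ J := J.max'_mem hJne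
      have hua : u ≤ a := by
        rcases Finset.mem_insert.1 huJ with h0 | h0
        · rw [h0]
          exact zero_le
        · exact (hI u h0).le
      set g : (ℝ≥0 → ℝ) × ℝ → ℝ≥0 → ℝ := fun q t => if t = a then q.1 u + q.2 else q.1 t with hg
      have hgm : Measurable g := by
        refine measurable_pi_lambda _ fun t => ?_
        by_cases ht : t = a
        · simp only [hg, ht, if_true]
          fun_prop
        · simp only [hg, ht, if_false]
          fun_prop
      have hZ : Measurable fun ω => coord h (u + (a - u)) ω - coord h u ω :=
        (measurable_coord h _).sub (measurable_coord h _)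
      have hcomp : sampleAt h (insert 0 (insert a I)) =
          g ∘ fun ω => (sampleAt h J ω, coord h (u + (a - u)) ω - coord h u ω) := by
        funext ω t
        rw [add_tsub_cancel_of_le hua]
        by_cases ht : t = a
        · simp [sampleAt, hg, ht, huJ]
        · simp [sampleAt, hg, ht, hJ]
      have hprod : ∀ μ : Measure (PathSpace h), IsFiniteMeasure μ →
          (∀ u v E A, MeasurableSet[canonicalFiltration h u] E → MeasurableSet A →
            μ (E ∩ {ω | coord h (u + v) ω - coord h u ω ∈ A}) = μ E * p v A) →
          μ.map (fun ω => (sampleAt h J ω, coord h (u + (a - u)) ω - coord h u ω)) =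
            (μ.map (sampleAt h J)).prod (p (a - u)) := by
        intro μ _ hμ
        refine (Measure.prod_eq fun A B hA hB => ?_).symm
        rw [Measure.map_apply ((hmeas J).prodMk hZ) (hA.prod hB), Measure.map_apply (hmeas J) hA]
        exact hμ u (a - u) _ B (measurable_sampleAt (fun s hs => J.le_max' s hs) hA) hB
      rw [hcomp, ← Measure.map_map hgm ((hmeas J).prodMk hZ),
        ← Measure.map_map hgm ((hmeas J).prodMk hZ), hprod μ₁ inferInstance h₁,
        hprod μ₂ inferInstance h₂, ih]
  refine map_eq_of_forall_sampleAt fun I => ?_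
  have hr : Measurable fun (y : ℝ≥0 → ℝ) t => if t ∈ I then y t else 0 := by
    refine measurable_pi_lambda _ fun t => ?_
    split_ifs <;> fun_prop
  have hcomp : sampleAt h I =
      (fun (y : ℝ≥0 → ℝ) t => if t ∈ I then y t else 0) ∘ sampleAt h (insert 0 I) := by
    funext ω t
    by_cases ht : t ∈ I <;> simp [sampleAt, ht]
  rw [hcomp, ← Measure.map_map hr (hmeas _), ← Measure.map_map hr (hmeas _), key]

end FiniteDimensional

section Markov

variable {P : Measure (PathSpace h)}

theorem measurable_shift_canonicalFiltration (s u : ℝ≥0) :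
    Measurable[canonicalFiltration h (s + u), canonicalFiltration h u] (shift h s) := by
  intro E hE
  obtain ⟨hEm, hEinv⟩ := measurableSet_canonicalFiltration_iff.1 hE
  refine measurableSet_canonicalFiltration_iff.2 ⟨measurable_shift s hEm, ?_⟩
  ext ω
  have hst : stopAt h u (shift h s (stopAt h (s + u) ω)) = stopAt h u (shift h s ω) := by
    refine pathSpace_ext fun t => ?_
    simp
  have hiff : ∀ η, η ∈ E ↔ stopAt h u η ∈ E := fun η => (Set.ext_iff.1 hEinv η).symm
  simp only [Set.mem_preimage]
  rw [hiff, hst, ← hiff]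

theorem IsLevyProcess.measure_inter_increment
    (hX : IsLevyProcess (canonicalFiltration h) (coord h) P) (u v : ℝ≥0) {E : Set (PathSpace h)}
    {A : Set ℝ} (hE : MeasurableSet[canonicalFiltration h u] E) (hA : MeasurableSet A) :
    P (E ∩ {ω | coord h (u + v) ω - coord h u ω ∈ A}) = P E * P.map (coord h v) A := by
  have h1 := (Indep_iff _ _ _).1 (hX.independent_increments u v) _ E ⟨A, hA, rfl⟩ hE
  rw [Set.inter_comm, mul_comm, ← hX.stationary_increments u v, Measure.map_apply
    (f := fun ω => coord h (u + v) ω - coord h u ω)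
    ((measurable_coord h _).sub (measurable_coord h _)) hA]
  exact h1

/-- The simple Markov property: the shifted increment path is independent of the past. -/
theorem IsLevyProcess.measure_inter_shift
    (hX : IsLevyProcess (canonicalFiltration h) (coord h) P) {s : ℝ≥0} {Λ B : Set (PathSpace h)}
    (hΛ : MeasurableSet[canonicalFiltration h s] Λ) (hB : MeasurableSet B) :
    P (Λ ∩ shift h s ⁻¹' B) = P Λ * P B := by
  have := hX.isProbabilityMeasure
  have hmap : (P.restrict Λ).map (shift h s) = P Λ • P := by
    have : IsFiniteMeasure (P Λ • P) := Measure.smul_finite P (measure_ne_top P Λ)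
    have : ∀ v, IsFiniteMeasure (P.map (coord h v)) := fun v => inferInstance
    refine eq_of_independent_increments (p := fun v => P.map (coord h v)) ?_ ?_ ?_ ?_ ?_
    · intro u v E A hE hA
      have hEm := (canonicalFiltration h).le u _ hE
      have hZm : MeasurableSet {ω | coord h (u + v) ω - coord h u ω ∈ A} :=
        ((measurable_coord h _).sub (measurable_coord h _)) hA
      rw [Measure.map_apply (measurable_shift s) (hEm.inter hZm),
        Measure.map_apply (measurable_shift s) hEm,
        Measure.restrict_apply (measurable_shift s (hEm.inter hZm)),
        Measure.restrict_apply (measurable_shift s hEm)]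
      have hΛE : MeasurableSet[canonicalFiltration h (s + u)] (shift h s ⁻¹' E ∩ Λ) :=
        @MeasurableSet.inter _ (canonicalFiltration h (s + u)) _ _
          (measurable_shift_canonicalFiltration s u hE)
          ((canonicalFiltration h).mono (le_self_add (a := s) (b := u)) _ hΛ)
      rw [← hX.measure_inter_increment (s + u) v hΛE hA]
      congr 1
      ext ω
      simp only [Set.mem_inter_iff, Set.mem_preimage, Set.mem_ofPred_eq, coord_shift, add_assoc,
        sub_sub_sub_cancel_right]
      tauto
    · intro u v E A hE hA
      simp only [Measure.smul_apply, smul_eq_mul]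
      rw [hX.measure_inter_increment u v hE hA, mul_assoc]
    · refine (ae_map_iff (p := fun ω => coord h 0 ω = 0) (measurable_shift s).aemeasurable
        (measurable_coord h 0 (measurableSet_singleton 0))).2 ?_
      exact Eventually.of_forall fun ω => by simp
    · exact Measure.ae_smul_measure hX.zero _
    · rw [Measure.map_apply (measurable_shift s) MeasurableSet.univ]
      simp
  have h1 := congrArg (fun μ => μ B) hmap
  simp only [Measure.map_apply (measurable_shift s) hB, Measure.smul_apply, smul_eq_mul,
    Measure.restrict_apply (measurable_shift s hB)] at h1
  rw [Set.inter_comm]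
  exact h1

theorem IsLevyProcess.lintegral_mul_comp_shift
    (hX : IsLevyProcess (canonicalFiltration h) (coord h) P) {s : ℝ≥0}
    {f g : PathSpace h → ℝ≥0∞} (hf : Measurable[canonicalFiltration h s] f) (hg : Measurable g) :
    ∫⁻ ω, f ω * g (shift h s ω) ∂P = (∫⁻ ω, f ω ∂P) * ∫⁻ ω, g ω ∂P := by
  have := hX.isProbabilityMeasure
  have hlaw : P.map (shift h s) = P := by
    ext B hB
    have := hX.measure_inter_shift (s := s) (Λ := Set.univ) (MeasurableSet.univ) hB
    rw [Measure.map_apply (measurable_shift s) hB]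
    simpa using this
  have hind : Indep (canonicalFiltration h s)
      (MeasurableSpace.comap (shift h s) inferInstance) P := by
    rw [Indep_iff]
    rintro Λ _ hΛ ⟨B, hB, rfl⟩
    rw [hX.measure_inter_shift hΛ hB, ← Measure.map_apply (measurable_shift s) hB, hlaw]
  have hgs : Measurable[MeasurableSpace.comap (shift h s) inferInstance]
      fun ω => g (shift h s ω) := hg.comp (comap_measurable (shift h s))
  rw [lintegral_mul_eq_lintegral_mul_lintegral_of_independent_measurableSpace
    ((canonicalFiltration h).le s) (measurable_shift s).comap_le hind hf hgs]
  congr 1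
  rw [← lintegral_map hg (measurable_shift s), hlaw]

end Markov

end

noncomputable section

variable {h : ℝ}

section Concatenation

/-- The value at time `t` of the path obtained by gluing together the increments of the paths
`η 0, η 1, …` over unit time intervals. -/
def concatValue (η : ℕ → PathSpace h) (t : ℝ≥0) : ℝ :=
  ∑ k ∈ Finset.range ⌊t⌋₊, (coord h 1 (η k) - coord h 0 (η k)) +
    (coord h (t - ⌊t⌋₊) (η ⌊t⌋₊) - coord h 0 (η ⌊t⌋₊))

theorem concatValue_mem (η : ℕ → PathSpace h) (t : ℝ≥0) :
    concatValue η t ∈ AddSubgroup.zmultiples h :=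
  AddSubgroup.add_mem _
    (AddSubgroup.sum_mem _ fun _ _ => AddSubgroup.sub_mem _ (coord_mem _ _) (coord_mem _ _))
    (AddSubgroup.sub_mem _ (coord_mem _ _) (coord_mem _ _))

theorem concatValue_eq_of_floor {η : ℕ → PathSpace h} {t : ℝ≥0} {n : ℕ} (hn : n ≤ t)
    (hn' : t < n + 1) : concatValue η t =
      ∑ k ∈ Finset.range n, (coord h 1 (η k) - coord h 0 (η k)) +
        (coord h (t - n) (η n) - coord h 0 (η n)) := by
  have : ⌊t⌋₊ = n := (Nat.floor_eq_iff zero_le).2 ⟨hn, hn'⟩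
  rw [concatValue, this]

theorem isCadlag_concatValue (η : ℕ → PathSpace h) : IsCadlag (concatValue η) := by
  have hsub : ∀ n : ℕ, Continuous fun s : ℝ≥0 => s - n := fun n =>
    continuous_id.sub continuous_const
  refine ⟨fun t => ?_, fun t => ?_⟩
  · set n := ⌊t⌋₊
    have hn : (n : ℝ≥0) ≤ t := Nat.floor_le zero_le
    have hn' : t < n + 1 := Nat.lt_floor_add_one t
    have hloc : (fun s => ∑ k ∈ Finset.range n, (coord h 1 (η k) - coord h 0 (η k)) +
        (coord h (s - n) (η n) - coord h 0 (η n))) =ᶠ[𝓝[≥] t] concatValue η := by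
      filter_upwards [self_mem_nhdsWithin,
        mem_nhdsWithin_of_mem_nhds (gt_mem_nhds hn')] with s h1 h2
      exact (concatValue_eq_of_floor (hn.trans h1) h2).symm
    refine ContinuousWithinAt.congr_of_eventuallyEq ?_ hloc.symm
      (concatValue_eq_of_floor hn hn')
    refine continuousWithinAt_const.add (ContinuousWithinAt.sub ?_ continuousWithinAt_const)
    refine ((η n).2.1.right_continuous (t - n)).comp (t := Set.Ici (t - n))
      (f := fun s : ℝ≥0 => s - n) (hsub n).continuousWithinAt ?_
    intro s hs
    exact tsub_le_tsub_right (Set.mem_Ici.1 hs) _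
  · rcases eq_or_ne t 0 with rfl | ht
    · exact ⟨0, by simp⟩
    obtain ⟨n, hn⟩ : ∃ n, ⌈t⌉₊ = n + 1 :=
      Nat.exists_eq_succ_of_ne_zero (Nat.ceil_pos.2 (pos_iff_ne_zero.2 ht)).ne'
    have hnt : (n : ℝ≥0) < t := by
      rw [← Nat.lt_ceil, hn]
      exact n.lt_succ_self
    have hnt' : t ≤ n + 1 := by
      have := Nat.le_ceil t
      rw [hn] at this
      exact_mod_cast this
    obtain ⟨l, hl⟩ := (η n).2.1.left_limits (t - n)
    refine ⟨∑ k ∈ Finset.range n, (coord h 1 (η k) - coord h 0 (η k)) + (l - coord h 0 (η n)), ?_⟩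
    have hloc : (fun s => ∑ k ∈ Finset.range n, (coord h 1 (η k) - coord h 0 (η k)) +
        (coord h (s - n) (η n) - coord h 0 (η n))) =ᶠ[𝓝[<] t] concatValue η := by
      filter_upwards [self_mem_nhdsWithin,
        mem_nhdsWithin_of_mem_nhds (lt_mem_nhds hnt)] with s h1 h2
      exact (concatValue_eq_of_floor (le_of_lt h2) (lt_of_lt_of_le h1 hnt')).symm
    refine Tendsto.congr' hloc ?_
    refine Tendsto.const_add _ (Tendsto.sub_const ?_ _)
    refine hl.comp (tendsto_nhdsWithin_iff.2 ⟨?_, ?_⟩)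
    · exact tendsto_nhdsWithin_of_tendsto_nhds ((hsub n).tendsto t)
    · filter_upwards [self_mem_nhdsWithin,
        mem_nhdsWithin_of_mem_nhds (lt_mem_nhds hnt)] with s h1 h2
      exact tsub_lt_tsub_right_of_le (le_of_lt h2) h1

/-- The path obtained by gluing together the increments of the paths `η 0, η 1, …` over unit time
intervals. -/
def concat (η : ℕ → PathSpace h) : PathSpace h :=
  ⟨concatValue η, isCadlag_concatValue η, concatValue_mem η⟩

theorem measurable_concat : Measurable (concat (h := h)) := by
  refine measurable_pathSpace_iff.2 fun t => ?_
  have hc : ∀ (s : ℝ≥0) (k : ℕ), Measurable fun η : ℕ → PathSpace h => coord h s (η k) :=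
    fun s k => (measurable_coord h s).comp (measurable_pi_apply k)
  exact (Finset.measurable_sum _ fun k _ => (hc _ k).sub (hc _ k)).add ((hc _ _).sub (hc _ _))

/-- The increments of a path over the `k`-th unit time interval, stopped at its end. -/
def piece (k : ℕ) (ω : PathSpace h) : PathSpace h := stopAt h 1 (shift h k ω)

theorem measurable_piece (k : ℕ) :
    Measurable[canonicalFiltration h (k + 1 : ℕ)] (piece (h := h) k) := by
  have h1 := (measurable_stopAt_canonicalFiltration (h := h) 1).comp
    (measurable_shift_canonicalFiltration (h := h) k 1)
  have h2 : ((k + 1 : ℕ) : ℝ≥0) = k + 1 := by push_cast; rfl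
  rw [h2]
  exact h1

theorem measurable_piece' (k : ℕ) : Measurable (piece (h := h) k) :=
  (measurable_piece k).mono ((canonicalFiltration h).le _) le_rfl

theorem concatValue_piece (ω : PathSpace h) (t : ℝ≥0) :
    concatValue (fun k => piece k ω) t = coord h t ω - coord h 0 ω := by
  have hn : (⌊t⌋₊ : ℝ≥0) ≤ t := Nat.floor_le zero_le
  have hn' : t - ⌊t⌋₊ ≤ 1 := by
    rw [tsub_le_iff_left]
    exact (Nat.lt_floor_add_one t).le
  have hsum : ∑ k ∈ Finset.range ⌊t⌋₊, (coord h 1 (piece k ω) - coord h 0 (piece k ω)) =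
      coord h ⌊t⌋₊ ω - coord h 0 ω := by
    have := Finset.sum_range_sub (fun k : ℕ => coord h k ω) ⌊t⌋₊
    rw [Nat.cast_zero] at this
    rw [← this]
    refine Finset.sum_congr rfl fun k _ => ?_
    simp [piece]
  rw [concatValue, hsum]
  simp [piece, min_eq_left hn', add_tsub_cancel_of_le hn]

/-- The sequence of paths that agrees with `ξ` below `n` and is the zero path from `n` on. -/
def extendZero (n : ℕ) (ξ : Finset.range n → PathSpace h) (k : ℕ) : PathSpace h :=
  if hk : k ∈ Finset.range n then ξ ⟨k, hk⟩
  else ⟨fun _ => 0, ⟨fun _ => continuousWithinAt_const, fun _ => ⟨0, tendsto_const_nhds⟩⟩,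
    fun _ => AddSubgroup.zero_mem _⟩

theorem measurable_extendZero (n : ℕ) : Measurable (extendZero (h := h) n) := by
  refine measurable_pi_lambda _ fun k => ?_
  unfold extendZero
  split_ifs with hk
  · exact measurable_pi_apply _
  · exact measurable_const

theorem extendZero_of_lt {n k : ℕ} (η : ℕ → PathSpace h) (hk : k < n) :
    extendZero n (fun i : Finset.range n => η i) k = η k := by
  simp [extendZero, hk]

theorem concatValue_extendZero (n : ℕ) (η : ℕ → PathSpace h) {t : ℝ≥0} (ht : t ≤ n) :
    concatValue (extendZero n fun i : Finset.range n => η i) t = concatValue η t := by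
  have hfl : ⌊t⌋₊ ≤ n := by
    have := Nat.floor_mono ht
    rwa [Nat.floor_natCast] at this
  have hsum : ∀ k ∈ Finset.range ⌊t⌋₊,
      coord h 1 (extendZero n (fun i : Finset.range n => η i) k) -
        coord h 0 (extendZero n (fun i : Finset.range n => η i) k) =
      coord h 1 (η k) - coord h 0 (η k) := by
    intro k hk
    rw [extendZero_of_lt η ((Finset.mem_range.1 hk).trans_le hfl)]
  rw [concatValue, concatValue, Finset.sum_congr rfl hsum]
  congr 1
  rcases hfl.eq_or_lt with heq | hlt
  · have : t - ⌊t⌋₊ = 0 := by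
      rw [heq]
      exact tsub_eq_zero_of_le ht
    rw [this, sub_self, sub_self]
  · rw [extendZero_of_lt η hlt]

theorem stopAt_concat_extendZero (n : ℕ) (η : ℕ → PathSpace h) :
    stopAt h n (concat (extendZero n fun i : Finset.range n => η i)) =
      stopAt h n (concat η) := by
  refine pathSpace_ext fun t => ?_
  rw [coord_stopAt, coord_stopAt]
  exact concatValue_extendZero n η (min_le_right _ _)

end Concatenation

section Existence

variable {P : Measure (PathSpace h)} {c : ℝ}

/-- The exponential weight of the path at time `t`. -/
def expWeight (h c : ℝ) (t : ℝ≥0) (ω : PathSpace h) : ℝ≥0∞ :=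
  ENNReal.ofReal (Real.exp (c * coord h t ω))

theorem measurable_expWeight_canonicalFiltration (t : ℝ≥0) :
    Measurable[canonicalFiltration h t] (expWeight h c t) :=
  ENNReal.measurable_ofReal.comp (Real.measurable_exp.comp
    ((measurable_coord_canonicalFiltration le_rfl).const_mul c))

theorem measurable_expWeight (t : ℝ≥0) : Measurable (expWeight h c t) :=
  (measurable_expWeight_canonicalFiltration t).mono ((canonicalFiltration h).le t) le_rfl

theorem expWeight_add (s t : ℝ≥0) (ω : PathSpace h) :
    expWeight h c (s + t) ω = expWeight h c s ω * expWeight h c t (shift h s ω) := by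
  rw [expWeight, expWeight, expWeight, ← ENNReal.ofReal_mul (Real.exp_pos _).le, ← Real.exp_add,
    coord_shift]
  ring_nf

theorem IsLevyProcess.setLIntegral_expWeight_inter
    (hX : IsLevyProcess (canonicalFiltration h) (coord h) P) (s t : ℝ≥0) {Λ B : Set (PathSpace h)}
    (hΛ : MeasurableSet[canonicalFiltration h s] Λ) (hB : MeasurableSet B) :
    ∫⁻ ω in Λ ∩ shift h s ⁻¹' B, expWeight h c (s + t) ω ∂P =
      (∫⁻ ω in Λ, expWeight h c s ω ∂P) * ∫⁻ ω in B, expWeight h c t ω ∂P := by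
  have hΛm := (canonicalFiltration h).le s _ hΛ
  have hf : Measurable[canonicalFiltration h s] (Λ.indicator (expWeight h c s)) :=
    (measurable_expWeight_canonicalFiltration s).indicator hΛ
  rw [← lintegral_indicator hΛm, ← lintegral_indicator hB,
    ← lintegral_indicator (hΛm.inter (measurable_shift s hB)),
    ← hX.lintegral_mul_comp_shift hf ((measurable_expWeight t).indicator hB)]
  refine lintegral_congr fun ω => ?_
  by_cases h1 : ω ∈ Λ <;> by_cases h2 : shift h s ω ∈ B <;>
    simp [h1, h2, expWeight_add]

/-- The exponentials `exp (c X_t)` form a martingale when they all have expectation one. -/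
theorem IsLevyProcess.setLIntegral_expWeight_eq
    (hX : IsLevyProcess (canonicalFiltration h) (coord h) P)
    (hexp : ∀ t : ℝ≥0, ∫⁻ ω, expWeight h c t ω ∂P = 1) {s t : ℝ≥0} (hst : s ≤ t)
    {Λ : Set (PathSpace h)} (hΛ : MeasurableSet[canonicalFiltration h s] Λ) :
    ∫⁻ ω in Λ, expWeight h c t ω ∂P = ∫⁻ ω in Λ, expWeight h c s ω ∂P := by
  have := hX.setLIntegral_expWeight_inter (c := c) s (t - s) hΛ MeasurableSet.univ
  rwa [add_tsub_cancel_of_le hst, Set.preimage_univ, Set.inter_univ, Measure.restrict_univ,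
    hexp, mul_one] at this

/-- The law, under the exponentially tilted measure, of the path up to time `1`. -/
def pieceLaw (P : Measure (PathSpace h)) (c : ℝ) : Measure (PathSpace h) :=
  (P.withDensity (expWeight h c 1)).map (stopAt h 1)

theorem pieceLaw_apply {B : Set (PathSpace h)} (hB : MeasurableSet B) :
    pieceLaw P c B = ∫⁻ ω in stopAt h 1 ⁻¹' B, expWeight h c 1 ω ∂P := by
  rw [pieceLaw, Measure.map_apply (measurable_stopAt 1) hB,
    withDensity_apply _ (measurable_stopAt 1 hB)]

theorem isProbabilityMeasure_pieceLaw (hexp : ∀ t : ℝ≥0, ∫⁻ ω, expWeight h c t ω ∂P = 1) :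
    IsProbabilityMeasure (pieceLaw P c) :=
  ⟨by rw [pieceLaw_apply MeasurableSet.univ, Set.preimage_univ, Measure.restrict_univ, hexp]⟩

theorem IsLevyProcess.setLIntegral_expWeight_pieces
    (hX : IsLevyProcess (canonicalFiltration h) (coord h) P)
    (hexp : ∀ t : ℝ≥0, ∫⁻ ω, expWeight h c t ω ∂P = 1) {B : ℕ → Set (PathSpace h)}
    (hB : ∀ k, MeasurableSet (B k)) (n : ℕ) :
    MeasurableSet[canonicalFiltration h n] {ω | ∀ k < n, piece k ω ∈ B k} ∧
      ∫⁻ ω in {ω | ∀ k < n, piece k ω ∈ B k}, expWeight h c n ω ∂P =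
        ∏ k ∈ Finset.range n, pieceLaw P c (B k) := by
  induction n with
  | zero => simp [hexp]
  | succ n ih =>
    have heq : {ω : PathSpace h | ∀ k < n + 1, piece k ω ∈ B k} =
        {ω | ∀ k < n, piece k ω ∈ B k} ∩ shift h n ⁻¹' (stopAt h 1 ⁻¹' B n) := by
      ext ω
      simp only [Set.mem_ofPred_eq, Nat.forall_lt_succ_right]
      rfl
    have hcast : ((n + 1 : ℕ) : ℝ≥0) = n + 1 := by push_cast; rfl
    rw [heq]
    constructor
    · refine @MeasurableSet.inter _ (canonicalFiltration h _) _ _ ?_ (measurable_piece n (hB n))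
      exact (canonicalFiltration h).mono (by exact_mod_cast n.le_succ) _ ih.1
    · rw [hcast, hX.setLIntegral_expWeight_inter _ _ ih.1 (measurable_stopAt 1 (hB n)), ih.2,
        Finset.prod_range_succ, pieceLaw_apply (hB n)]

theorem IsLevyProcess.map_pieces_withDensity
    (hX : IsLevyProcess (canonicalFiltration h) (coord h) P)
    (hexp : ∀ t : ℝ≥0, ∫⁻ ω, expWeight h c t ω ∂P = 1) (n : ℕ) :
    (P.withDensity (expWeight h c n)).map (fun ω (i : Finset.range n) => piece (i : ℕ) ω) =
      Measure.pi fun _ : Finset.range n => pieceLaw P c := by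
  have := isProbabilityMeasure_pieceLaw hexp
  refine (Measure.pi_eq fun B hB => ?_).symm
  set B' : ℕ → Set (PathSpace h) := fun k =>
    if hk : k ∈ Finset.range n then B ⟨k, hk⟩ else Set.univ with hB'
  have hBm : ∀ k, MeasurableSet (B' k) := by
    intro k
    simp only [hB']
    split_ifs with hk
    · exact hB _
    · exact MeasurableSet.univ
  have hBi : ∀ i : Finset.range n, B' i = B i := fun i => by simp only [hB', i.2, dif_pos]
  have hmeas : Measurable fun ω (i : Finset.range n) => piece (h := h) (i : ℕ) ω :=
    measurable_pi_lambda _ fun i => measurable_piece' _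
  have heq : (fun ω (i : Finset.range n) => piece (h := h) (i : ℕ) ω) ⁻¹' Set.univ.pi B =
      {ω | ∀ k < n, piece k ω ∈ B' k} := by
    ext ω
    simp only [Set.mem_preimage, Set.mem_pi, Set.mem_univ, true_imp_iff, Set.mem_ofPred_eq]
    constructor
    · intro H k hk
      have := H ⟨k, Finset.mem_range.2 hk⟩
      rwa [← hBi] at this
    · intro H i
      rw [← hBi]
      exact H i (Finset.mem_range.1 i.2)
  have hpieces := hX.setLIntegral_expWeight_pieces hexp hBm n
  rw [Measure.map_apply hmeas (MeasurableSet.univ_pi hB), heq,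
    withDensity_apply _ ((canonicalFiltration h).le _ _ hpieces.1), hpieces.2,
    ← Finset.prod_coe_sort]
  exact Finset.prod_congr rfl fun i _ => by rw [hBi]

/-- The exponentially tilted measure: the law of the concatenation of independent pieces. -/
def tilted (P : Measure (PathSpace h)) (c : ℝ) : Measure (PathSpace h) :=
  (Measure.infinitePi fun _ : ℕ => pieceLaw P c).map concat

theorem IsLevyProcess.tilted_apply_nat
    (hX : IsLevyProcess (canonicalFiltration h) (coord h) P)
    (hexp : ∀ t : ℝ≥0, ∫⁻ ω, expWeight h c t ω ∂P = 1) (n : ℕ) {Λ : Set (PathSpace h)}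
    (hΛ : MeasurableSet[canonicalFiltration h n] Λ) :
    tilted P c Λ = ∫⁻ ω in Λ, expWeight h c n ω ∂P := by
  have := isProbabilityMeasure_pieceLaw hexp
  obtain ⟨hΛm, hinv⟩ := measurableSet_canonicalFiltration_iff.1 hΛ
  have hiff : ∀ η, η ∈ Λ ↔ stopAt h n η ∈ Λ := fun η => (Set.ext_iff.1 hinv η).symm
  have hce : Measurable fun ξ : Finset.range n → PathSpace h => concat (extendZero n ξ) :=
    measurable_concat.comp (measurable_extendZero n)
  have hpre : concat ⁻¹' Λ = (Finset.range n).restrict ⁻¹'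
      ((fun ξ : Finset.range n → PathSpace h => concat (extendZero n ξ)) ⁻¹' Λ) := by
    ext η
    simp only [Set.mem_preimage]
    rw [hiff, ← stopAt_concat_extendZero, ← hiff]
    rfl
  have hmeas : Measurable fun ω (i : Finset.range n) => piece (h := h) (i : ℕ) ω :=
    measurable_pi_lambda _ fun i => measurable_piece' _
  rw [tilted, Measure.map_apply measurable_concat hΛm, hpre,
    ← Measure.map_apply (Finset.measurable_restrict _) (hce hΛm), Measure.infinitePi_map_restrict,
    ← hX.map_pieces_withDensity hexp n, Measure.map_apply hmeas (hce hΛm),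
    ← withDensity_apply _ hΛm]
  refine measure_congr (withDensity_absolutelyContinuous P _ |>.ae_le ?_)
  filter_upwards [hX.zero] with ω hω
  refine propext ?_
  change concat (extendZero n fun i : Finset.range n => piece (i : ℕ) ω) ∈ Λ ↔ ω ∈ Λ
  rw [hiff, stopAt_concat_extendZero n fun k => piece k ω, ← hiff]
  have : concat (fun k => piece k ω) = ω := by
    refine pathSpace_ext fun t => ?_
    change concatValue _ t = _
    rw [concatValue_piece, hω, sub_zero]
  rw [this]

theorem IsLevyProcess.tilted_apply
    (hX : IsLevyProcess (canonicalFiltration h) (coord h) P)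
    (hexp : ∀ t : ℝ≥0, ∫⁻ ω, expWeight h c t ω ∂P = 1) (t : ℝ≥0) {Λ : Set (PathSpace h)}
    (hΛ : MeasurableSet[canonicalFiltration h t] Λ) :
    tilted P c Λ = ∫⁻ ω in Λ, expWeight h c t ω ∂P := by
  obtain ⟨n, hn⟩ := exists_nat_ge t
  rw [hX.tilted_apply_nat hexp n ((canonicalFiltration h).mono hn _ hΛ),
    hX.setLIntegral_expWeight_eq hexp hn hΛ]

end Existence

end

noncomputable section

variable {h : ℝ} {ν : Measure ℝ} {P Q : Measure (PathSpace h)} {c : ℝ}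

theorem isExponentialChange_iff (hψ : laplaceExponent ν c = 0) :
    IsExponentialChange P ν c Q ↔ ∀ (t : ℝ≥0) (Λ : Set (PathSpace h)),
      MeasurableSet[canonicalFiltration h t] Λ → Q Λ = ∫⁻ ω in Λ, expWeight h c t ω ∂P := by
  simp only [IsExponentialChange, hψ, zero_mul, sub_zero, expWeight]

/-- A measure is determined by its values on `⋃ t, 𝓕_t`. -/
theorem eq_of_forall_canonicalFiltration {Q₁ Q₂ : Measure (PathSpace h)} [IsFiniteMeasure Q₁]
    [IsFiniteMeasure Q₂] (H : ∀ (t : ℝ≥0) (Λ : Set (PathSpace h)),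
      MeasurableSet[canonicalFiltration h t] Λ → Q₁ Λ = Q₂ Λ) : Q₁ = Q₂ := by
  refine map_eq_of_forall_sampleAt fun I => ?_
  have hm := measurable_sampleAt (h := h) (t := I.sup id)
    fun s hs => Finset.le_sup (f := id) hs
  have hm' : Measurable (sampleAt h I) := hm.mono ((canonicalFiltration h).le _) le_rfl
  ext A hA
  rw [Measure.map_apply hm' hA, Measure.map_apply hm' hA]
  exact H _ _ (hm hA)

theorem IsUpwardsSkipFreeLevyChain.lintegral_expWeight
    (hX : IsUpwardsSkipFreeLevyChain (canonicalFiltration h) (coord h) P h ν) (hc : 0 ≤ c)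
    (hψ : laplaceExponent ν c = 0) (t : ℝ≥0) : ∫⁻ ω, expWeight h c t ω ∂P = 1 := by
  have := hX.lintegral_exp hc t
  rwa [hψ, mul_zero, Real.exp_zero, ENNReal.ofReal_one] at this

section Change

variable {x : ℝ}
  (hX : IsUpwardsSkipFreeLevyChain (canonicalFiltration h) (coord h) P h ν)
  (hc : 0 < c) (hψ : laplaceExponent ν c = 0)
  (hQ : ∀ (t : ℝ≥0) (Λ : Set (PathSpace h)),
      MeasurableSet[canonicalFiltration h t] Λ → Q Λ = ∫⁻ ω in Λ, expWeight h c t ω ∂P)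

include hX hc hψ hQ

theorem isProbabilityMeasure_of_change : IsProbabilityMeasure Q :=
  ⟨by rw [hQ 0 _ MeasurableSet.univ, Measure.restrict_univ, hX.lintegral_expWeight hc.le hψ]⟩

omit hψ in
/-- Under the change of measure the coordinate process drifts to `∞`. -/
theorem measure_coord_lt_le (t : ℝ≥0) :
    Q {ω | coord h t ω < x} ≤
      ENNReal.ofReal (Real.exp (c / 2 * x) * Real.exp (t * laplaceExponent ν (c / 2))) := by
  have hm : MeasurableSet[canonicalFiltration h t] {ω | coord h t ω < x} :=
    measurable_coord_canonicalFiltration le_rfl measurableSet_Iio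
  rw [hQ t _ hm, ← lintegral_indicator ((canonicalFiltration h).le t _ hm),
    ENNReal.ofReal_mul (Real.exp_pos _).le, ← hX.lintegral_exp (half_pos hc).le t]
  change _ ≤ _ * ∫⁻ ω, expWeight h (c / 2) t ω ∂P
  rw [← lintegral_const_mul _ (measurable_expWeight (c := c / 2) t)]
  refine lintegral_mono fun ω => ?_
  by_cases hω : ω ∈ {ω | coord h t ω < x}
  · rw [Set.indicator_of_mem hω, expWeight, expWeight, ← ENNReal.ofReal_mul (Real.exp_pos _).le,
      ← Real.exp_add]
    refine ENNReal.ofReal_le_ofReal (Real.exp_le_exp.2 ?_)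
    have : coord h t ω < x := hω
    nlinarith
  · rw [Set.indicator_of_notMem hω]
    exact zero_le

theorem measure_entranceTime_lt_top_compl : Q {ω | entranceTime h x ω < ⊤}ᶜ = 0 := by
  have := hX.isCompoundPoissonProcess.isFiniteMeasure
  have hneg : laplaceExponent ν (c / 2) < 0 := laplaceExponent_half_neg hX.ae_le
    hX.isCompoundPoissonProcess.ne_zero hX.isCompoundPoissonProcess.singleton_zero hc hψ
  have hle : ∀ n : ℕ, Q {ω | entranceTime h x ω < ⊤}ᶜ ≤
      ENNReal.ofReal (Real.exp (c / 2 * x) * Real.exp (n * laplaceExponent ν (c / 2))) := by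
    intro n
    refine le_trans (measure_mono fun ω hω => ?_) (measure_coord_lt_le hX hc hQ (x := x) n)
    rw [Set.mem_compl_iff, Set.mem_ofPred_eq, entranceTime_lt_top_iff, not_exists] at hω
    exact not_le.1 (hω n)
  have hlim : Tendsto (fun n : ℕ => ENNReal.ofReal
      (Real.exp (c / 2 * x) * Real.exp (n * laplaceExponent ν (c / 2)))) atTop (𝓝 0) := by
    rw [← ENNReal.ofReal_zero, ← mul_zero (Real.exp (c / 2 * x))]
    refine ENNReal.tendsto_ofReal (Tendsto.const_mul _ ?_)
    exact Real.tendsto_exp_atBot.comp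
      (tendsto_natCast_atTop_atTop.atTop_mul_const_of_neg hneg)
  exact le_antisymm (ge_of_tendsto' hlim hle) zero_le

omit hc hψ in
/-- The change of measure on the event that the path is at level `y` at the dyadic time following
the entrance time. -/
theorem measure_inter_gridTime_eq {Λ : Set (PathSpace h)} (hΛ : IsObserved h x Λ) (m : ℕ) (y : ℝ) :
    Q (Λ ∩ {ω | entranceTime h x ω < ⊤} ∩
        {ω | coord h (gridTime m (gridIndex m (entranceTimeReal h x ω))) ω = y}) =
      ENNReal.ofReal (Real.exp (c * y)) * P (Λ ∩ {ω | entranceTime h x ω < ⊤} ∩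
        {ω | coord h (gridTime m (gridIndex m (entranceTimeReal h x ω))) ω = y}) := by
  have hpos := hX.pos
  set A : ℕ → Set (PathSpace h) := fun k =>
    Λ ∩ {ω | entranceTime h x ω ≤ gridTime m k} ∩
      (⋂ j ∈ Finset.range k, {ω | entranceTime h x ω ≤ gridTime m j}ᶜ) ∩
      {ω | coord h (gridTime m k) ω = y} with hA
  have hle : ∀ (ω : PathSpace h) (k : ℕ), entranceTime h x ω < ⊤ →
      (entranceTime h x ω ≤ gridTime m k ↔ gridIndex m (entranceTimeReal h x ω) ≤ k) := by
    intro ω k hω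
    rw [gridIndex_le_iff, ← coe_entranceTimeReal hω]
    exact WithTop.coe_le_coe
  have hmem : ∀ ω k, ω ∈ A k ↔ (ω ∈ Λ ∧ entranceTime h x ω < ⊤) ∧
      gridIndex m (entranceTimeReal h x ω) = k ∧ coord h (gridTime m k) ω = y := by
    intro ω k
    simp only [hA, Set.mem_inter_iff, Set.mem_ofPred_eq, Set.mem_iInter, Finset.mem_range,
      Set.mem_compl_iff]
    constructor
    · rintro ⟨⟨⟨h1, h2⟩, h3⟩, h4⟩
      have hlt := h2.trans_lt (WithTop.coe_lt_top _)
      refine ⟨⟨h1, hlt⟩, le_antisymm ((hle ω k hlt).1 h2) ?_, h4⟩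
      by_contra! hk
      exact h3 _ hk ((hle ω _ hlt).2 le_rfl)
    · rintro ⟨⟨h1, hlt⟩, h2, h3⟩
      refine ⟨⟨⟨h1, (hle ω k hlt).2 h2.le⟩, fun j hj => ?_⟩, h3⟩
      rw [hle ω j hlt, h2]
      omega
  have hAm : ∀ k, MeasurableSet[canonicalFiltration h (gridTime m k)] (A k) := by
    intro k
    have hset : MeasurableSet[canonicalFiltration h (gridTime m k)]
        (⋂ j ∈ Finset.range k, {ω | entranceTime h x ω ≤ gridTime m j}ᶜ) := by
      refine Finset.measurableSet_biInter _ fun j hj => ?_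
      refine MeasurableSet.compl ?_
      exact (canonicalFiltration h).mono (gridTime_mono m (Finset.mem_range.1 hj).le) _
        (measurableSet_canonicalFiltration_entranceTime_le hpos _)
    exact MeasurableSet.inter (MeasurableSet.inter (hΛ.2 _) hset)
      (measurable_coord_canonicalFiltration le_rfl (measurableSet_singleton y))
  have hAm' : ∀ k, MeasurableSet (A k) := fun k => (canonicalFiltration h).le _ _ (hAm k)
  have hunion : Λ ∩ {ω | entranceTime h x ω < ⊤} ∩
      {ω | coord h (gridTime m (gridIndex m (entranceTimeReal h x ω))) ω = y} = ⋃ k, A k := by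
    ext ω
    simp only [Set.mem_iUnion, hmem]
    simp
  have hdisj : Pairwise (Function.onFun Disjoint A) := by
    intro k l hkl
    refine Set.disjoint_left.2 fun ω h1 h2 => hkl ?_
    rw [hmem] at h1 h2
    exact h1.2.1.symm.trans h2.2.1
  rw [hunion, measure_iUnion hdisj hAm', measure_iUnion hdisj hAm', ← ENNReal.tsum_mul_left]
  congr 1
  funext k
  rw [hQ _ _ (hAm k)]
  have hconst : ∀ ω ∈ A k, expWeight h c (gridTime m k) ω = ENNReal.ofReal (Real.exp (c * y)) := by
    intro ω hω
    rw [expWeight, ((hmem ω k).1 hω).2.2]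
  rw [setLIntegral_congr_fun (hAm' k) hconst, setLIntegral_const]

theorem measure_inter_entrance_eq {Λ : Set (PathSpace h)} (hΛ : IsObserved h x Λ) (y : ℝ) :
    Q (Λ ∩ {ω | entranceTime h x ω < ⊤} ∩ {ω | coord h (entranceTimeReal h x ω) ω = y}) =
      ENNReal.ofReal (Real.exp (c * y)) * P (Λ ∩ {ω | entranceTime h x ω < ⊤} ∩
        {ω | coord h (entranceTimeReal h x ω) ω = y}) := by
  have hpos := hX.pos
  have := isProbabilityMeasure_of_change hX hc hψ hQ
  have := hX.isCompoundPoissonProcess.isLevyProcess.isProbabilityMeasure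
  have hB := hΛ.1.inter (measurableSet_entranceTime_lt_top (x := x) hpos)
  have hτ := measurable_entranceTimeReal (x := x) hpos
  have hgrid : ∀ m, Measurable fun ω =>
      coord h (gridTime m (gridIndex m (entranceTimeReal h x ω))) ω := fun m => by
    refine measurable_coord_comp hpos ?_
    exact (measurable_from_nat (f := gridTime m)).comp (Nat.measurable_ceil.comp (hτ.mul_const _))
  have hlim : ∀ μ : Measure (PathSpace h), IsFiniteMeasure μ →
      Tendsto (fun m => μ (Λ ∩ {ω | entranceTime h x ω < ⊤} ∩
        {ω | coord h (gridTime m (gridIndex m (entranceTimeReal h x ω))) ω = y})) atTop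
      (𝓝 (μ (Λ ∩ {ω | entranceTime h x ω < ⊤} ∩
        {ω | coord h (entranceTimeReal h x ω) ω = y}))) := by
    intro μ _
    refine tendsto_measure_of_tendsto_indicator_of_isFiniteMeasure atTop μ
      (fun m => hB.inter (hgrid m (measurableSet_singleton y))) fun ω => ?_
    filter_upwards [eventually_coord_gridTime_eq hpos ω (entranceTimeReal h x ω)] with m hm
    simp only [Set.mem_inter_iff, Set.mem_ofPred_eq, hm]
  refine tendsto_nhds_unique (hlim Q inferInstance) ?_
  simp_rw [measure_inter_gridTime_eq hX hQ hΛ]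
  exact ENNReal.Tendsto.const_mul (hlim P inferInstance) (Or.inr ENNReal.ofReal_ne_top)

omit hc hψ in
theorem measure_entrance_ne_eq_zero (hx : 0 ≤ x) :
    Q {ω | entranceTime h x ω < ⊤ ∧ coord h (entranceTimeReal h x ω) ω ≠ latticeCeil h x} = 0 := by
  have hpos := hX.pos
  have hsub : {ω | entranceTime h x ω < ⊤ ∧
      coord h (entranceTimeReal h x ω) ω ≠ latticeCeil h x} ⊆
      ⋃ n : ℕ, stoppedPath h x ⁻¹' {η | coord h n η ≠ latticeCeil h x} ∩
        {ω | entranceTime h x ω ≤ (n : ℝ≥0)} := by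
    rintro ω ⟨hω, hne⟩
    obtain ⟨n, hn⟩ := exists_nat_ge (entranceTimeReal h x ω)
    have hle : entranceTime h x ω ≤ (n : ℝ≥0) := by
      rw [← coe_entranceTimeReal hω]
      exact_mod_cast hn
    refine Set.mem_iUnion.2 ⟨n, ?_, hle⟩
    rwa [Set.mem_preimage, Set.mem_ofPred_eq, coord_stoppedPath_of_le hle]
  refine measure_mono_null hsub (measure_iUnion_null fun n => ?_)
  have hm : MeasurableSet {η | coord h n η ≠ latticeCeil h x} :=
    (measurable_coord h n (measurableSet_singleton _)).compl
  rw [hQ n _ ((IsObserved.preimage_stoppedPath hpos hm).2 n)]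
  refine setLIntegral_measure_zero _ _ ?_
  refine measure_mono_null ?_ (ae_iff.1 (ae_coord_entranceTime_eq hX hx))
  rintro ω ⟨h1, h2⟩ H
  rw [Set.mem_preimage, Set.mem_ofPred_eq, coord_stoppedPath_of_le h2] at h1
  exact h1 (H (lt_of_le_of_lt h2 (WithTop.coe_lt_top _)))

theorem measure_eq_mul_of_isObserved (hx : 0 ≤ x) {Λ : Set (PathSpace h)}
    (hΛ : IsObserved h x Λ) : Q Λ = ENNReal.ofReal (Real.exp (c * latticeCeil h x)) *
      P (Λ ∩ {ω | entranceTime h x ω < ⊤}) := by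
  have hP : P (Λ ∩ {ω | entranceTime h x ω < ⊤}) = P (Λ ∩ {ω | entranceTime h x ω < ⊤} ∩
      {ω | coord h (entranceTimeReal h x ω) ω = latticeCeil h x}) := by
    refine measure_congr ?_
    filter_upwards [ae_coord_entranceTime_eq hX hx] with ω hω
    exact propext ⟨fun H => ⟨H, hω H.2⟩, fun H => H.1⟩
  have hQ' : Q Λ = Q (Λ ∩ {ω | entranceTime h x ω < ⊤} ∩
      {ω | coord h (entranceTimeReal h x ω) ω = latticeCeil h x}) := by
    refine measure_congr ?_
    have h1 : ∀ᵐ ω ∂Q, entranceTime h x ω < ⊤ :=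
      ae_iff.2 (measure_entranceTime_lt_top_compl hX hc hψ hQ)
    have h2 : ∀ᵐ ω ∂Q, ¬(entranceTime h x ω < ⊤ ∧
        coord h (entranceTimeReal h x ω) ω ≠ latticeCeil h x) := by
      rw [ae_iff]
      simpa only [not_not] using measure_entrance_ne_eq_zero hX hQ hx
    filter_upwards [h1, h2] with ω h1 h2
    exact propext ⟨fun H => ⟨⟨H, h1⟩, not_not.1 fun hne => h2 ⟨h1, hne⟩⟩, fun H => H.1.1⟩
  rw [hP, hQ', measure_inter_entrance_eq hX hc hψ hQ hΛ]

/-- On events observed up to the entrance time, the change of measure is conditioning on the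
entrance time being finite. -/
theorem cond_eq_of_isObserved (hx : 0 ≤ x) {Λ : Set (PathSpace h)} (hΛ : IsObserved h x Λ) :
    cond P {ω | entranceTime h x ω < ⊤} Λ = Q Λ := by
  have hpos := hX.pos
  have := isProbabilityMeasure_of_change hX hc hψ hQ
  have h1 := measure_eq_mul_of_isObserved hX hc hψ hQ hx
    (IsObserved.preimage_stoppedPath (x := x) hpos MeasurableSet.univ)
  rw [Set.preimage_univ, measure_univ, Set.univ_inter] at h1
  rw [cond_apply (measurableSet_entranceTime_lt_top hpos),
    measure_eq_mul_of_isObserved hX hc hψ hQ hx hΛ,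
    ENNReal.eq_inv_of_mul_eq_one_left h1.symm, Set.inter_comm]

theorem tendsto_measure_entranceTime_le (t : ℝ≥0) :
    Tendsto (fun n : ℕ => Q {ω | entranceTime h (n * h) ω ≤ t}) atTop (𝓝 0) := by
  have hpos := hX.pos
  have := isProbabilityMeasure_of_change hX hc hψ hQ
  have := tendsto_measure_iInter_atTop (μ := Q)
    (fun n : ℕ => (measurableSet_entranceTime_le (x := n * h) hpos t).nullMeasurableSet)
    (antitone_entranceTime_le hpos t) ⟨0, measure_ne_top _ _⟩
  rwa [iInter_entranceTime_le_eq_empty hpos t, measure_empty] at this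

theorem tendsto_cond_overallSup {t : ℝ≥0} {Λ : Set (PathSpace h)}
    (hΛ : MeasurableSet[canonicalFiltration h t] Λ) :
    Tendsto (fun n : ℕ => cond P {ω | (((n : ℝ) * h : ℝ) : EReal) ≤ overallSup ω} Λ)
      atTop (𝓝 (Q Λ)) := by
  have hpos := hX.pos
  have := isProbabilityMeasure_of_change hX hc hψ hQ
  have hlim := tendsto_measure_entranceTime_le hX hc hψ hQ t
  have hn : ∀ n : ℕ, 0 ≤ (n : ℝ) * h := fun n => by positivity
  have hE : ∀ n : ℕ, {ω : PathSpace h | (((n : ℝ) * h : ℝ) : EReal) ≤ overallSup ω} =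
      {ω | entranceTime h (n * h) ω < ⊤} := fun n => by
    ext ω
    exact le_overallSup_iff hpos n ω
  simp_rw [hE]
  have hobs : ∀ n : ℕ, cond P {ω | entranceTime h (n * h) ω < ⊤}
      (Λ ∩ {ω | entranceTime h (n * h) ω ≤ t}ᶜ) =
        Q (Λ ∩ {ω | entranceTime h (n * h) ω ≤ t}ᶜ) := fun n =>
    cond_eq_of_isObserved hX hc hψ hQ (hn n) (IsObserved.inter_entranceTime_gt hpos hΛ)
  have hobs' : ∀ n : ℕ, cond P {ω | entranceTime h (n * h) ω < ⊤}
      {ω | entranceTime h (n * h) ω ≤ t} = Q {ω | entranceTime h (n * h) ω ≤ t} := fun n =>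
    cond_eq_of_isObserved hX hc hψ hQ (hn n) (IsObserved.entranceTime_le hpos t)
  have hsplit : ∀ (μ : Measure (PathSpace h)) (n : ℕ), μ Λ ≤
      μ (Λ ∩ {ω | entranceTime h (n * h) ω ≤ t}ᶜ) + μ {ω | entranceTime h (n * h) ω ≤ t} := by
    intro μ n
    refine (measure_mono fun ω hω => ?_).trans (measure_union_le _ _)
    by_cases h1 : entranceTime h (n * h) ω ≤ t
    · exact Or.inr h1
    · exact Or.inl ⟨hω, h1⟩
  refine tendsto_of_tendsto_of_tendsto_of_le_of_le
    (g := fun n : ℕ => Q Λ - Q {ω | entranceTime h (n * h) ω ≤ t})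
    (h := fun n : ℕ => Q Λ + Q {ω | entranceTime h (n * h) ω ≤ t}) ?_ ?_ (fun n => ?_) fun n => ?_
  · have := ENNReal.Tendsto.sub (tendsto_const_nhds (x := Q Λ)) hlim
      (Or.inl (measure_ne_top Q Λ))
    rwa [tsub_zero] at this
  · simpa using hlim.const_add (Q Λ)
  · refine tsub_le_iff_right.2 ((hsplit Q n).trans ?_)
    rw [← hobs n]
    exact add_le_add (measure_mono Set.inter_subset_left) le_rfl
  · refine (hsplit _ n).trans ?_
    rw [hobs n, hobs' n]
    exact add_le_add (measure_mono Set.inter_subset_left) le_rfl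

theorem identDistrib_stoppedPath (hx : 0 ≤ x) :
    IdentDistrib (stoppedPath h x) (stoppedPath h x) Q
      (cond P {ω | entranceTime h x ω < ⊤}) := by
  have hpos := hX.pos
  have hm := measurable_stoppedPath (x := x) hpos
  refine ⟨hm.aemeasurable, hm.aemeasurable, ?_⟩
  ext B hB
  rw [Measure.map_apply hm hB, Measure.map_apply hm hB]
  exact (cond_eq_of_isObserved hX hc hψ hQ hx (IsObserved.preimage_stoppedPath hpos hB)).symm

end Change

end

end SkipFree

theorem mainTheorem11 (h : ℝ) (ν : Measure ℝ) (P : Measure (SkipFree.PathSpace h))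
    (hX : SkipFree.IsUpwardsSkipFreeLevyChain (SkipFree.canonicalFiltration h)
      (SkipFree.coord h) P h ν)
    (hΦ : 0 < SkipFree.largestZero ν) :
    (∃! Q : Measure (SkipFree.PathSpace h),
      SkipFree.IsExponentialChange P ν (SkipFree.largestZero ν) Q) ∧
    ∀ Q : Measure (SkipFree.PathSpace h),
      SkipFree.IsExponentialChange P ν (SkipFree.largestZero ν) Q →
      (∀ (t : ℝ≥0) (Λ : Set (SkipFree.PathSpace h)),
        MeasurableSet[SkipFree.canonicalFiltration h t] Λ →
        Tendsto (fun n : ℕ => ProbabilityTheory.cond P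
            {ω | (((n : ℝ) * h : ℝ) : EReal) ≤ SkipFree.overallSup ω} Λ)
          atTop (𝓝 (Q Λ))) ∧
      (∀ x : ℝ, 0 ≤ x →
        IdentDistrib (SkipFree.stoppedPath h x) (SkipFree.stoppedPath h x) Q
          (ProbabilityTheory.cond P {ω | SkipFree.entranceTime h x ω < ⊤})) := by
  have := hX.isCompoundPoissonProcess.isFiniteMeasure
  have hψ := SkipFree.laplaceExponent_largestZero hX.ae_le hX.pos hΦ
  have hL := hX.isCompoundPoissonProcess.isLevyProcess
  have hexp := hX.lintegral_expWeight hΦ.le hψ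
  simp only [SkipFree.isExponentialChange_iff hψ]
  refine ⟨⟨SkipFree.tilted P (SkipFree.largestZero ν), fun t Λ hΛ => hL.tilted_apply hexp t hΛ,
    fun Q hQ => ?_⟩, fun Q hQ => ⟨fun t Λ hΛ => ?_, fun x hx => ?_⟩⟩
  · have := SkipFree.isProbabilityMeasure_of_change hX hΦ hψ hQ
    have := SkipFree.isProbabilityMeasure_of_change hX hΦ hψ
      (fun t Λ hΛ => hL.tilted_apply hexp t hΛ)
    refine SkipFree.eq_of_forall_canonicalFiltration fun t Λ hΛ => ?_
    rw [hQ t Λ hΛ, hL.tilted_apply hexp t hΛ]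
  · exact SkipFree.tendsto_cond_overallSup hX hΦ hψ hQ hΛ
  · exact SkipFree.identDistrib_stoppedPath hX hΦ hψ hQ hx
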